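/- A simple edge-labelled digraph $D$ consists of a finite vertex set $V(D)$, a set $E(D)$ of ordered pairs of vertices (so each edge $uv$ occurs at most once, while $uv$ and $vu$ may both occur), a finite set $X_0$ disjoint from $V(D)$ (the set of non-vertex labels), and a labelling $f:E(D)\to V(D)\cup X_0$. The elements of $V(D)\cup X_0$ are called the labels, whether or not they occur on an edge. $D$ is out-properly labelled if, for each vertex, all edges going out of it have different labels. A switching path in $D$ is a sequence of distinct vertices $(p_0,\dots,p_d)$, $d\ge 0$, such that $p_ip_{i+1}$ is an edge for $0\le i<d$, these $d$ edges have different labels, and whenever $p_ip_{i+1}$ is labelled by a vertex $w\in V(D)$, we have $w=p_j$ for some $1\le j\le i$. A label $\ell$ is amidst $u$ and $v$ if there is a switching path $(p_0,\dots,p_d)$ with $p_0=u$ and $p_d=v$ such that no edge of it is labelled by $\ell$ and, if $\ell$ is a vertex, $\ell=p_j$ for some $1\le j\le d$. For a set $A$ of labels and a vertex $v$, let $N^+_A(v)$ be the set of vertices $w$ such that $vw$ is an edge with label in $A$. **Theorem.** For every $\epsilon$ with $0<\epsilon\le 0.9$ there is an $N_0=N_0(\epsilon)$ such that the following holds. Let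 $D$ be an out-properly edge-labelled, simple digraph on $n\ge N_0$ vertices, and let $X_0$ be its set of non-vertex labels. Then for every vertex $u\in V(D)$ there are a vertex $v\in V(D)$ and a set $A\subseteq V(D)\cup X_0$ of labels, each of which is amidst $u$ and $v$, such that $$|N^+_A(v)|<|A|-|X_0|+\epsilon n.$$ -/

import Mathlib

/-- An edge-labelled directed graph with vertex set `V` and set of non-vertex labels `X`.
There is at most one edge from `u` to `v` (and possibly one from `v` to `u`), and every edge
carries a label which is either a vertex (`Sum.inl`) or a non-vertex label (`Sum.inr`).
The set of all labels is `V ⊕ X`, whether or not they occur on an edge. -/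
structure LabelledDigraph (V X : Type*) extends Digraph V where
  /-- The label of an edge. -/
  label : ∀ {u v : V}, Adj u v → V ⊕ X

namespace LabelledDigraph

/-- `uv` is an edge of `D`, and it is labelled by `l`. -/
def HasLabel {V X : Type*} (D : LabelledDigraph V X) (u v : V) (l : V ⊕ X) : Prop :=
  ∃ h : D.Adj u v, D.label h = l

/-- Distinct edges going out of the same vertex have different labels. -/
def OutProper {V X : Type*} (D : LabelledDigraph V X) : Prop :=
  ∀ (u v w : V) (l : V ⊕ X), D.HasLabel u v l → D.HasLabel u w l → v = w

/-- `(p 0, p 1, …, p d)` is a switching path of length `d` in `D`; the values of `p` beyond `d`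
are irrelevant. Length `0` (a single vertex) is allowed. -/
structure IsSwitchingPath {V X : Type*} (D : LabelledDigraph V X) (p : ℕ → V) (d : ℕ) :
    Prop where
  /-- The vertices of a path are distinct. -/
  distinct : ∀ i ≤ d, ∀ j ≤ d, p i = p j → i = j
  /-- Consecutive vertices are joined by an edge. -/
  adj : ∀ i < d, D.Adj (p i) (p (i + 1))
  /-- The edges of the path have different labels. -/
  rainbow : ∀ i < d, ∀ j < d, ∀ l : V ⊕ X,
    D.HasLabel (p i) (p (i + 1)) l → D.HasLabel (p j) (p (j + 1)) l → i = j
  /-- If an edge of the path is labelled by a vertex, then this vertex is a non-starting vertex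
  of the path that comes no later than the tail of the edge. -/
  consistent : ∀ i < d, ∀ v : V, D.HasLabel (p i) (p (i + 1)) (Sum.inl v) →
    ∃ j, 1 ≤ j ∧ j ≤ i ∧ p j = v

/-- The label `l` is amidst `u` and `v`: some switching path from `u` to `v` has no edge labelled
`l` and, in case `l` is a vertex, passes through `l` at a non-starting position. -/
def Amidst {V X : Type*} (D : LabelledDigraph V X) (u v : V) (l : V ⊕ X) : Prop :=
  ∃ (d : ℕ) (p : ℕ → V), D.IsSwitchingPath p d ∧ p 0 = u ∧ p d = v ∧
    (∀ i < d, ¬ D.HasLabel (p i) (p (i + 1)) l) ∧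
    (∀ c : V, l = Sum.inl c → ∃ j, 1 ≤ j ∧ j ≤ d ∧ p j = c)

/-- The set of out-neighbours `w` of `v` for which the edge `vw` has its label in `A`. -/
def outNeighbors {V X : Type*} (D : LabelledDigraph V X) (A : Set (V ⊕ X)) (v : V) : Set V :=
  {w | ∃ l ∈ A, D.HasLabel v w l}

end LabelledDigraph

/-! Suppose every vertex `v` and every set `A` of labels amidst `u` and `v` satisfy `|N⁺_A(v)| ≥ |A|
- |X₀| + εn`. The contradiction comes from a growing set `U` of vertices that can be used as labels
almost freely: a hub. A hub has a root `w` such that any `k` labels from `U ∪ X₀`, apart from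
boundedly many exceptions and bounded conflicts, are made available together by one switching path
from `u` to `w`.

A short path from `w` whose labels come from the hub can be appended to such a switching path. At
its end `v`, almost all of `U ∪ X₀` is therefore amidst `u` and `v`. Expansion gives about `|U| +
εn` out-neighbours, so about `εn` of them lie outside `U` (`IsHub.le_card_extensions`). The set
reached after `i` steps cannot keep growing linearly, so it soon stalls on a set `W` inside which
all out-degrees are at least `εn/2` (`IsHub.exists_layer`).

Inside `W` a density increment on the relation "many short routes" yields a set `C` of at least `δn`
vertices, any two of which have many short routes between them (`exists_core`). The only obstruction
to passing through a bounded set of vertices of `C` while avoiding a few labels is that some label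
may occupy linearly many of the edges entering a vertex. A vertex has boundedly many such heavy
labels, and a label is heavy at boundedly many vertices. Away from conflicts between heavy labels,
short paths through prescribed vertices exist (`exists_linked_core`).

Hence `U ∪ C` is again a hub, with root in `C`, and its conflicts are inherited from the heavy
labels (`IsHub.extend`). Since `C` is disjoint from `U` and `δ` depends only on `ε`, more than `1/δ`
extensions would give `|U| > n`. -/

section

open Finset

/-! ### Double counting and cores of dense relations -/

/-- A Markov-type inequality by double counting. -/
theorem card_filter_le_mul_le {α β : Type*} (A : Finset α) (B : Finset β) (r : α → β → Prop)
    [∀ a b, Decidable (r a b)] (t K : ℝ) (h : ∀ b ∈ B, (#{a ∈ A | r a b} : ℝ) ≤ K) :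
    (#{a ∈ A | t ≤ (#{b ∈ B | r a b} : ℝ)} : ℝ) * t ≤ K * #B := by
  calc (#{a ∈ A | t ≤ (#{b ∈ B | r a b} : ℝ)} : ℝ) * t
      = ∑ a ∈ A with t ≤ (#{b ∈ B | r a b} : ℝ), t := by rw [sum_const, nsmul_eq_mul]
    _ ≤ ∑ a ∈ A with t ≤ (#{b ∈ B | r a b} : ℝ), (#{b ∈ B | r a b} : ℝ) :=
        sum_le_sum fun a ha => (mem_filter.1 ha).2
    _ ≤ ∑ a ∈ A, (#{b ∈ B | r a b} : ℝ) :=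
        sum_le_sum_of_subset_of_nonneg (filter_subset _ _) fun _ _ _ => Nat.cast_nonneg _
    _ = ∑ b ∈ B, (#{a ∈ A | r a b} : ℝ) := by
        have := sum_card_bipartiteAbove_eq_sum_card_bipartiteBelow (s := A) (t := B) r
        simp only [bipartiteAbove, bipartiteBelow] at this
        exact_mod_cast this
    _ ≤ ∑ _b ∈ B, K := sum_le_sum h
    _ = K * #B := by rw [sum_const, nsmul_eq_mul, mul_comm]

/-- Starting from a relation `r`, repeatedly relate `x` to `y` if at least `b` vertices of `W`
lie between them. -/
def DenseReach {V : Type*} (W : Finset V) (b : ℝ) (r : V → V → Prop) : ℕ → V → V → Prop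
  | 0 => r
  | j + 1 => fun x y => DenseReach W b r j x y ∨
      b ≤ ({v | v ∈ W ∧ DenseReach W b r j x v ∧ DenseReach W b r j v y}.ncard : ℝ)

theorem DenseReach.mono {V : Type*} {W : Finset V} {b : ℝ} {r : V → V → Prop} {i j : ℕ}
    (h : i ≤ j) {x y : V} (hxy : DenseReach W b r i x y) : DenseReach W b r j x y := by
  induction h with
  | refl => exact hxy
  | step _ ih => exact Or.inl ih

open scoped Classical in
/-- If one level of `DenseReach` adds little to the smallest out-neighbourhood, then there is
a large set in which everything is related to everything at the next level. -/
theorem exists_core_of_increment {V : Type*} (W : Finset V) (r s : V → V → Prop)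
    (n γ ξ β : ℝ) (hn : 0 < n) (hγ : 0 < γ) (hγ1 : γ ≤ 1) (hξ : ξ = γ ^ 2 / 64)
    (hβ : β = ξ * (γ / 8)) (hW : (#W : ℝ) ≤ n) (hrs : ∀ x y, r x y → s x y)
    (hs : ∀ x y, β * n ≤ (#{v ∈ W | r x v ∧ r v y} : ℝ) → s x y)
    (m : ℝ) (hm : γ * n ≤ m) (hr : ∀ x ∈ W, m ≤ (#{y ∈ W | r x y} : ℝ))
    (x : V) (hx : x ∈ W) (hxm : (#{y ∈ W | s x y} : ℝ) ≤ m + ξ * n) :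
    ∃ C ⊆ W, γ / 2 * n ≤ (#C : ℝ) ∧ ∀ y ∈ C, ∀ z ∈ C, s y z := by
  have hξ0 : 0 < ξ := by rw [hξ]; positivity
  have hβ0 : 0 < β := by rw [hβ]; positivity
  obtain ⟨C₀, hC₀⟩ : ∃ C, C = {y ∈ W | s x y} := ⟨_, rfl⟩
  rw [← hC₀] at hxm
  obtain ⟨A, hA⟩ : ∃ A, A = {y ∈ W | r x y} := ⟨_, rfl⟩
  have hAC : A ⊆ C₀ := fun y hy => by
    simp only [hA, hC₀, mem_filter] at hy ⊢; exact ⟨hy.1, hrs _ _ hy.2⟩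
  -- A vertex outside `C₀` has fewer than `β * n` in-neighbours in `A`, since otherwise `s` would
  -- relate `x` to it. So few vertices of `A` send many `r`-edges out of `C₀`, and `B` discards
  -- these.
  obtain ⟨B, hB⟩ : ∃ B, B = {y ∈ A | ¬ ξ * n ≤ (#{z ∈ W \ C₀ | r y z} : ℝ)} := ⟨_, rfl⟩
  have hBA : B ⊆ A := hB ▸ filter_subset _ _
  have hAW : A ⊆ W := hA ▸ filter_subset _ _
  have h1 : (#{y ∈ A | ξ * n ≤ (#{z ∈ W \ C₀ | r y z} : ℝ)} : ℝ) * (ξ * n) ≤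
      β * n * #(W \ C₀) := by
    apply card_filter_le_mul_le
    intro z hz
    simp only [hC₀, mem_sdiff, mem_filter, not_and] at hz
    have h := mt (hs x z) (hz.2 hz.1)
    rw [hA, filter_filter]
    exact le_of_lt (not_le.1 h)
  have h2 : (#{y ∈ A | ξ * n ≤ (#{z ∈ W \ C₀ | r y z} : ℝ)} : ℝ) ≤ γ / 8 * n := by
    have h3 : (#(W \ C₀) : ℝ) ≤ n := le_trans (by exact_mod_cast card_le_card sdiff_subset) hW
    have h4 : β * n * #(W \ C₀) ≤ (γ / 8 * n) * (ξ * n) := by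
      calc β * n * #(W \ C₀) ≤ β * n * n := by gcongr
        _ = _ := by rw [hβ]; ring
    exact le_of_mul_le_mul_right (h1.trans h4) (by positivity)
  have hBcard : 7 / 8 * γ * n ≤ (#B : ℝ) := by
    have h3 : #{y ∈ A | ξ * n ≤ (#{z ∈ W \ C₀ | r y z} : ℝ)} + #B = #A := by
      rw [hB]; exact card_filter_add_card_filter_not _
    have h4 : (#{y ∈ A | ξ * n ≤ (#{z ∈ W \ C₀ | r y z} : ℝ)} : ℝ) + #B = #A := by
      exact_mod_cast h3
    have := hr x hx
    rw [← hA] at this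
    linarith
  -- `y` has at least `m` out-neighbours, fewer than `ξ * n` of them outside `C₀`, while `C₀` has at
  -- most `m + ξ * n` elements. So `y` misses at most `2 * ξ * n` of `C₀ ⊇ B`.
  have hmiss : ∀ y ∈ B, (#{z ∈ B | ¬ r y z} : ℝ) ≤ 2 * ξ * n := by
    intro y hy
    have hyW : y ∈ W := hAW (hBA hy)
    have h3 := hr y hyW
    have h4 : ¬ ξ * n ≤ (#{z ∈ W \ C₀ | r y z} : ℝ) := by
      rw [hB] at hy; exact (mem_filter.1 hy).2
    have h5 : #{z ∈ W | r y z} + #{z ∈ B | ¬ r y z} ≤ #{z ∈ W \ C₀ | r y z} + #C₀ := by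
      rw [← card_union_of_disjoint, ← card_union_of_disjoint]
      · apply card_le_card
        intro z
        simp only [mem_union, mem_filter, mem_sdiff]
        rintro (⟨hz, hz'⟩ | ⟨hz, hz'⟩)
        · by_cases h : z ∈ C₀
          · exact Or.inr h
          · exact Or.inl ⟨⟨hz, h⟩, hz'⟩
        · exact Or.inr (hAC (hBA hz))
      · exact disjoint_left.2 fun z hz hz' => by
          simp only [mem_filter, mem_sdiff] at hz
          exact hz.1.2 hz'
      · exact disjoint_left.2 fun z hz hz' => (mem_filter.1 hz').2 (mem_filter.1 hz).2
    have h6 : (#{z ∈ W | r y z} : ℝ) + #{z ∈ B | ¬ r y z} ≤ #{z ∈ W \ C₀ | r y z} + #C₀ := by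
      exact_mod_cast h5
    linarith
  have hBn : (#B : ℝ) ≤ n :=
    le_trans (by exact_mod_cast card_le_card (hBA.trans hAW)) hW
  have h7 : (#{z ∈ B | γ / 4 * n ≤ (#{y ∈ B | ¬ r y z} : ℝ)} : ℝ) * (γ / 4 * n) ≤
      2 * ξ * n * #B :=
    card_filter_le_mul_le B B (fun z y => ¬ r y z) _ _ hmiss
  have h8 : (#{z ∈ B | γ / 4 * n ≤ (#{y ∈ B | ¬ r y z} : ℝ)} : ℝ) ≤ γ / 8 * n := by
    have h9 : 2 * ξ * n * #B ≤ (γ / 8 * n) * (γ / 4 * n) := by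
      calc 2 * ξ * n * #B ≤ 2 * ξ * n * n := by gcongr
        _ = _ := by rw [hξ]; ring
    exact le_of_mul_le_mul_right (h7.trans h9) (by positivity)
  -- Remove also the vertices missed by many of `B`. For `y`, `z` in the rest, at least `7/8 - 1/32
  -- - 1/4 > 1/8` times `γ * n` vertices of `B` lie between them, enough for `s y z`.
  refine ⟨{z ∈ B | ¬ γ / 4 * n ≤ (#{y ∈ B | ¬ r y z} : ℝ)},
    (filter_subset _ _).trans (hBA.trans hAW), ?_, ?_⟩
  · have h3 : #{z ∈ B | γ / 4 * n ≤ (#{y ∈ B | ¬ r y z} : ℝ)} +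
        #{z ∈ B | ¬ γ / 4 * n ≤ (#{y ∈ B | ¬ r y z} : ℝ)} = #B :=
      card_filter_add_card_filter_not _
    have h4 : (#{z ∈ B | γ / 4 * n ≤ (#{y ∈ B | ¬ r y z} : ℝ)} : ℝ) +
        #{z ∈ B | ¬ γ / 4 * n ≤ (#{y ∈ B | ¬ r y z} : ℝ)} = #B := by exact_mod_cast h3
    have : 0 < γ * n := by positivity
    linarith
  · intro y hy z hz
    obtain ⟨hyB, -⟩ := mem_filter.1 hy
    obtain ⟨hzB, hz'⟩ := mem_filter.1 hz
    apply hs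
    have h3 : #B ≤ #{v ∈ W | r y v ∧ r v z} + #{v ∈ B | ¬ r y v} + #{v ∈ B | ¬ r v z} := by
      refine le_trans (card_le_card ?_) ((card_union_le _ _).trans
        (Nat.add_le_add_right (card_union_le _ _) _))
      intro v hv
      have := hAW (hBA hv)
      simp only [mem_union, mem_filter]
      tauto
    have h4 : (#B : ℝ) ≤ #{v ∈ W | r y v ∧ r v z} + #{v ∈ B | ¬ r y v} +
        #{v ∈ B | ¬ r v z} := by exact_mod_cast h3
    have h5 := hmiss y hyB
    have h6 : 2 * ξ * n ≤ γ / 32 * n := by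
      have : 2 * ξ ≤ γ / 32 := by rw [hξ]; nlinarith
      gcongr
    have h9 : β * n ≤ γ / 8 * n := by
      have : β ≤ γ / 8 := by
        have : ξ ≤ 1 := by rw [hξ]; nlinarith
        rw [hβ]; nlinarith
      gcongr
    have : 0 < γ * n := by positivity
    linarith

/-- A dense relation has, after boundedly many steps of `DenseReach`, a large set of vertices
that are pairwise related. -/
theorem exists_core (γ : ℝ) (hγ : 0 < γ) (hγ1 : γ ≤ 1) :
    ∃ J : ℕ, ∃ β : ℝ, 0 < β ∧ ∀ {V : Type*} (W : Finset V) (r : V → V → Prop) (n : ℝ),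
      0 < n → (#W : ℝ) ≤ n → W.Nonempty →
      (∀ x ∈ W, γ * n ≤ ({y | y ∈ W ∧ r x y}.ncard : ℝ)) →
      ∃ C ⊆ W, γ / 2 * n ≤ (#C : ℝ) ∧ ∀ y ∈ C, ∀ z ∈ C, DenseReach W (β * n) r J y z := by
  classical
  set ξ : ℝ := γ ^ 2 / 64 with hξ
  have hξ0 : 0 < ξ := by positivity
  obtain ⟨J, hJ⟩ := exists_nat_gt (1 / ξ)
  refine ⟨J, ξ * (γ / 8), by positivity, ?_⟩
  intro V W r n hn hW hne hdeg
  set s := DenseReach W (ξ * (γ / 8) * n) r with hs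
  have hcast : ∀ (p : V → Prop), ({y | y ∈ W ∧ p y}.ncard : ℝ) = #{y ∈ W | p y} := by
    intro p
    rw [← Set.ncard_coe_finset]
    simp
  have hmin : ∀ j, ∃ x ∈ W, ∀ y ∈ W, #{z ∈ W | s j x z} ≤ #{z ∈ W | s j y z} := fun j =>
    exists_min_image W (fun x => #{z ∈ W | s j x z}) hne
  choose a ha ha' using hmin
  -- If the minimum out-degree rose by more than `ξ * n` at each of `J > 1 / ξ` levels, it would
  -- exceed `n`.
  obtain ⟨j, hj, hinc⟩ : ∃ j < J,
      (#{z ∈ W | s (j + 1) (a (j + 1)) z} : ℝ) ≤ #{z ∈ W | s j (a j) z} + ξ * n := by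
    by_contra! hcon
    have hgrow : ∀ j ≤ J, j * (ξ * n) ≤ (#{z ∈ W | s j (a j) z} : ℝ) := by
      intro j
      induction j with
      | zero => intro _; simp
      | succ j ih =>
        intro hj
        have h1 := ih (by omega)
        have h2 := hcon j (by omega)
        push_cast
        linarith
    have h1 := hgrow J le_rfl
    have h2 : (#{z ∈ W | s J (a J) z} : ℝ) ≤ n :=
      le_trans (by exact_mod_cast card_le_card (filter_subset _ _)) hW
    have h3 : 1 < J * ξ := by rwa [div_lt_iff₀ hξ0] at hJ
    nlinarith
  have hmono : ∀ x, #{y ∈ W | s 0 x y} ≤ #{y ∈ W | s j x y} := fun x =>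
    card_le_card fun y hy => by
      simp only [mem_filter] at hy ⊢
      exact ⟨hy.1, DenseReach.mono (Nat.zero_le j) hy.2⟩
  obtain ⟨C, hCW, hC, hC'⟩ := exists_core_of_increment W (s j) (s (j + 1)) n γ ξ
    (ξ * (γ / 8)) hn hγ hγ1 hξ rfl hW (fun x y h => Or.inl h)
    (fun x y h => Or.inr (h.trans_eq (by rw [hcast]; congr!))) (#{z ∈ W | s j (a j) z})
    (by
      have h1 := hdeg (a j) (ha j)
      rw [hcast] at h1
      have h2 := hmono (a j)
      have h3 : (#{y ∈ W | s 0 (a j) y} : ℝ) ≤ #{y ∈ W | s j (a j) y} := by exact_mod_cast h2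
      exact h1.trans h3)
    (fun x hx => by exact_mod_cast ha' j x hx) (a (j + 1)) (ha _) hinc
  exact ⟨C, hCW, hC, fun y hy z hz => DenseReach.mono hj (hC' y hy z hz)⟩

/-! ### Out-labellings, conflicts and conflict-free paths -/

/-- A labelling of edges inside `W`: every edge has one label, and edges out of a vertex have
different labels. -/
structure IsOutLabelling {V L : Type*} (W : Finset V) (E : V → V → L → Prop) : Prop where
  tail_mem : ∀ {x y l}, E x y l → x ∈ W
  head_mem : ∀ {x y l}, E x y l → y ∈ W
  label_unique : ∀ {x y l m}, E x y l → E x y m → l = m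
  head_unique : ∀ {x y z l}, E x y l → E x z l → y = z

/-- `conf l` is the set of labels in conflict with `l`. -/
structure IsConflict {L : Type*} (conf : L → Finset L) (e : ℕ) : Prop where
  refl : ∀ l, l ∈ conf l
  symm : ∀ {l m}, l ∈ conf m → m ∈ conf l
  card_le : ∀ l, #(conf l) ≤ e

theorem IsConflict.card_biUnion_le {L : Type*} [DecidableEq L] {conf : L → Finset L} {e : ℕ}
    (h : IsConflict conf e) (Y : Finset L) : #(Y.biUnion conf) ≤ e * #Y := by
  rw [mul_comm]
  exact card_biUnion_le_card_mul _ _ _ fun l _ => h.card_le l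

theorem IsConflict.disjoint_biUnion_comm {L : Type*} [DecidableEq L] {conf : L → Finset L}
    {e : ℕ} (h : IsConflict conf e) {A B : Finset L} (hAB : Disjoint A (B.biUnion conf)) :
    Disjoint B (A.biUnion conf) := by
  rw [disjoint_left] at hAB ⊢
  intro b hb hb'
  obtain ⟨a, ha, hba⟩ := mem_biUnion.1 hb'
  exact hAB ha (mem_biUnion.2 ⟨b, hb, h.symm hba⟩)

/-- Paths from `x` whose labels are pairwise free of conflicts, together with the set of
non-starting vertices and the set of labels. -/
inductive ConflictFreePath {V L : Type*} [DecidableEq V] [DecidableEq L]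
    (E : V → V → L → Prop) (conf : L → Finset L) (x : V) : V → Finset V → Finset L → Prop
  | nil : ConflictFreePath E conf x x ∅ ∅
  | snoc {y z : V} {Zs : Finset V} {Ls : Finset L} {l : L} :
      ConflictFreePath E conf x y Zs Ls → E y z l → z ∉ Zs → z ≠ x → (∀ m ∈ Ls, l ∉ conf m) →
      ConflictFreePath E conf x z (insert z Zs) (insert l Ls)

namespace ConflictFreePath

variable {V L : Type*} [DecidableEq V] [DecidableEq L] {E : V → V → L → Prop}
  {conf : L → Finset L} {x y z : V} {Zs Zs' : Finset V} {Ls Ls' : Finset L}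

theorem end_mem (h : ConflictFreePath E conf x y Zs Ls) : y = x ∨ y ∈ Zs := by
  cases h <;> simp

theorem trans (h : ConflictFreePath E conf x y Zs Ls)
    (h' : ConflictFreePath E conf y z Zs' Ls') (hZ : ∀ v ∈ Zs', v ∉ Zs ∧ v ≠ x)
    (hL : ∀ l ∈ Ls', ∀ m ∈ Ls, l ∉ conf m) :
    ConflictFreePath E conf x z (Zs ∪ Zs') (Ls ∪ Ls') := by
  induction h' with
  | nil => simpa using h
  | @snoc a b A B l _ hE hb _ hl ih =>
    rw [union_insert, union_insert]
    refine .snoc (ih (fun v hv => hZ v (mem_insert_of_mem hv))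
      fun l hl => hL l (mem_insert_of_mem hl)) hE ?_ (hZ b (mem_insert_self _ _)).2 ?_
    · rw [mem_union, not_or]
      exact ⟨(hZ b (mem_insert_self _ _)).1, hb⟩
    · intro m hm
      obtain hm | hm := mem_union.1 hm
      · exact hL l (mem_insert_self _ _) m hm
      · exact hl m hm

theorem indep {e : ℕ} (hc : IsConflict conf e) (h : ConflictFreePath E conf x y Zs Ls) :
    ∀ a ∈ Ls, ∀ b ∈ Ls, a ≠ b → b ∉ conf a := by
  induction h with
  | nil => simp
  | @snoc _ _ _ _ l _ _ _ _ hl ih =>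
    intro a ha b hb hab
    rw [mem_insert] at ha hb
    obtain ha | ha := ha <;> obtain hb | hb := hb
    · exact absurd (ha.trans hb.symm) hab
    · exact fun h => hl b hb (hc.symm (ha ▸ h))
    · exact fun h => hl a ha (hb ▸ h)
    · exact ih a ha b hb hab

theorem mono {E' : V → V → L → Prop} (hE : ∀ x y l, E x y l → E' x y l)
    (h : ConflictFreePath E conf x y Zs Ls) : ConflictFreePath E' conf x y Zs Ls := by
  induction h with
  | nil => exact .nil
  | snoc _ he hz hx hl ih => exact .snoc ih (hE _ _ _ he) hz hx hl

theorem vertex_prop {p : V → Prop} (hE : ∀ x y l, E x y l → p y)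
    (h : ConflictFreePath E conf x y Zs Ls) : ∀ z ∈ Zs, p z := by
  induction h with
  | nil => simp
  | snoc _ he _ _ _ ih =>
    intro z hz
    obtain rfl | hz := mem_insert.1 hz
    · exact hE _ _ _ he
    · exact ih z hz

theorem label_prop {p : L → Prop} (hE : ∀ x y l, E x y l → p l)
    (h : ConflictFreePath E conf x y Zs Ls) : ∀ l ∈ Ls, p l := by
  induction h with
  | nil => simp
  | snoc _ he _ _ _ ih =>
    intro z hz
    obtain rfl | hz := mem_insert.1 hz
    · exact hE _ _ _ he
    · exact ih z hz

end ConflictFreePath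

/-! ### Heavy labels and robust linking -/

/-- There is a conflict-free path of length at most `d` from `x` to `y` through `T` that has no
label in `Y` and no non-starting vertex in `Z`. -/
def Linked {V L : Type*} [DecidableEq V] [DecidableEq L] (E : V → V → L → Prop)
    (conf : L → Finset L) (d : ℕ) (x y : V) (T : Finset V) (Y : Finset L) (Z : Finset V) : Prop :=
  ∃ Zs Ls, ConflictFreePath E conf x y Zs Ls ∧ #Zs ≤ d ∧ #Ls ≤ d ∧ Disjoint Ls Y ∧
    Disjoint Zs Z ∧ T ⊆ Zs

/-- The labels that occur on at least `t` edges into `y`. -/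
noncomputable def heavyLabels {V L : Type*} [Fintype L] (E : V → V → L → Prop) (t : ℝ) (y : V) :
    Finset L := by
  classical exact {l | t ≤ ({v | E v y l}.ncard : ℝ)}

theorem mem_heavyLabels {V L : Type*} [Fintype L] {E : V → V → L → Prop} {t : ℝ} {y : V} {l : L} :
    l ∈ heavyLabels E t y ↔ t ≤ ({v | E v y l}.ncard : ℝ) := by
  simp [heavyLabels]

theorem heavyLabels_anti {V L : Type*} [Fintype L] {E : V → V → L → Prop} {s t : ℝ} (h : s ≤ t)
    (y : V) : heavyLabels E t y ⊆ heavyLabels E s y := by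
  intro l
  rw [mem_heavyLabels, mem_heavyLabels]
  exact h.trans

-- The fibres of a partial function on `V` are disjoint, so at most `1 / θ` of them are large. Used
-- in two ways: an edge has one label, and a label has one head per tail.
open scoped Classical in
theorem card_heavy_le {V β : Type*} [Fintype V] [Fintype β] (r : V → β → Prop)
    (h : ∀ v a b, r v a → r v b → a = b) (θ : ℝ) (hθ : 0 < θ) (hV : 0 < Fintype.card V) :
    (#{b | θ * Fintype.card V ≤ ({v | r v b}.ncard : ℝ)} : ℝ) ≤ 1 / θ := by
  have hV' : (0 : ℝ) < Fintype.card V := by exact_mod_cast hV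
  have h1 := card_filter_le_mul_le (univ : Finset β) (univ : Finset V) (fun b v => r v b)
    (θ * Fintype.card V) 1 (by
      intro v _
      have : #{b | r v b} ≤ 1 := card_le_one.2 fun a ha b hb => h v a b (by simpa using ha)
        (by simpa using hb)
      exact_mod_cast this)
  have h2 : ∀ b, {v | r v b}.ncard = #{v | r v b} := fun b => by
    rw [← Set.ncard_coe_finset]; simp
  simp only [h2]
  rw [one_mul, card_univ] at h1
  rw [le_div_iff₀ hθ]
  refine le_of_mul_le_mul_right ?_ hV'
  rw [mul_assoc, one_mul]
  exact h1

theorem card_heavyLabels_le {V L : Type*} [Fintype V] [Fintype L] {W : Finset V}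
    {E : V → V → L → Prop} (hE : IsOutLabelling W E) (θ : ℝ) (hθ : 0 < θ)
    (hV : 0 < Fintype.card V) (y : V) :
    (#(heavyLabels E (θ * Fintype.card V) y) : ℝ) ≤ 1 / θ :=
  card_heavy_le (fun v l => E v y l) (fun _ _ _ => hE.label_unique) θ hθ hV

open scoped Classical in
theorem card_heavy_at_le {V L : Type*} [Fintype V] [Fintype L] {W : Finset V}
    {E : V → V → L → Prop} (hE : IsOutLabelling W E) (θ : ℝ) (hθ : 0 < θ)
    (hV : 0 < Fintype.card V) (l : L) :
    (#{y | l ∈ heavyLabels E (θ * Fintype.card V) y} : ℝ) ≤ 1 / θ := by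
  simp only [mem_heavyLabels]
  exact card_heavy_le (fun v y => E v y l) (fun _ _ _ => hE.head_unique) θ hθ hV

/-- At least `b` vertices are the middle of a conflict-free path of length two from `x` to `y`. -/
def TwoStep {V L : Type*} (E : V → V → L → Prop) (conf : L → Finset L) (b : ℝ) (x y : V) : Prop :=
  b ≤ ({v | ∃ l m, E x v l ∧ E v y m ∧ m ∉ conf l}.ncard : ℝ)

/-- Forbidden labels on the first edge exclude one middle vertex each, because the labels out of `x`
are different. On the second edge every forbidden label is light at `y`, so `θ = β / (2 * (K + 1))`
keeps that loss to half of the middle vertices. -/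
theorem linked_of_twoStep (β : ℝ) (hβ : 0 < β) (K : ℕ) :
    ∃ θ : ℝ, 0 < θ ∧ ∃ N : ℕ, ∀ {V L : Type*} [Fintype V] [Fintype L] [DecidableEq V]
      [DecidableEq L] (W : Finset V) (E : V → V → L → Prop) (conf : L → Finset L)
      (x y : V) (Y : Finset L) (Z : Finset V), IsOutLabelling W E → N ≤ Fintype.card V →
      x ≠ y → TwoStep E conf (β * Fintype.card V) x y → #Y ≤ K → #Z ≤ K →
      Disjoint (heavyLabels E (θ * Fintype.card V) y) Y → y ∉ Z → Linked E conf 2 x y ∅ Y Z := by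
  obtain ⟨N, hN⟩ := exists_nat_gt ((4 * K + 4) / β)
  refine ⟨β / (2 * (K + 1)), by positivity, N, ?_⟩
  intro V L _ _ _ _ W E conf x y Y Z hE hn hxy h2 hY hZ hd hyZ
  classical
  set n : ℝ := ((Fintype.card V : ℕ) : ℝ) with hndef
  have hNn : (N : ℝ) ≤ n := by rw [hndef]; exact_mod_cast hn
  have hnbig : 4 * K + 4 < β * n := by
    rw [div_lt_iff₀ hβ] at hN
    nlinarith
  have hn0 : 0 < n := by
    by_contra! h
    have : β * n ≤ 0 := mul_nonpos_of_nonneg_of_nonpos hβ.le h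
    have : (0 : ℝ) ≤ K := by positivity
    linarith
  obtain ⟨v, ⟨l, m, hl, hm, hlm⟩, hv⟩ : ∃ v ∈ {v | ∃ l m, E x v l ∧ E v y m ∧ m ∉ conf l},
      v ∉ Z ∪ {x, y} ∪ Y.biUnion (fun l => {v | E x v l}) ∪ Y.biUnion (fun l => {v | E v y l}) := by
    by_contra! hcon
    have h3 := Set.ncard_le_ncard (show {v | ∃ l m, E x v l ∧ E v y m ∧ m ∉ conf l} ⊆
      ↑(Z ∪ {x, y} ∪ Y.biUnion (fun l => {v | E x v l}) ∪
        Y.biUnion (fun l => {v | E v y l})) from fun v hv => hcon v hv)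
    rw [Set.ncard_coe_finset] at h3
    have h4 : #(Y.biUnion (fun l => ({v | E x v l} : Finset V))) ≤ #Y * 1 :=
      card_biUnion_le_card_mul _ _ _ fun l _ => card_le_one.2 fun a ha b hb =>
        hE.head_unique (mem_filter.1 ha).2 (mem_filter.1 hb).2
    have h5 : (#(Y.biUnion (fun l => ({v | E v y l} : Finset V))) : ℝ) ≤ β * n / 2 := by
      calc (#(Y.biUnion (fun l => ({v | E v y l} : Finset V))) : ℝ)
          ≤ ∑ l ∈ Y, (#({v | E v y l} : Finset V) : ℝ) := by exact_mod_cast card_biUnion_le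
        _ ≤ ∑ l ∈ Y, β / (2 * (K + 1)) * n := by
            refine sum_le_sum fun l hl => ?_
            have := disjoint_right.1 hd hl
            rw [mem_heavyLabels, not_le] at this
            refine le_trans (le_of_eq ?_) this.le
            rw [← Set.ncard_coe_finset]
            simp
        _ = #Y * (β / (2 * (K + 1)) * n) := by rw [sum_const, nsmul_eq_mul]
        _ ≤ (K + 1) * (β / (2 * (K + 1)) * n) := by
            have : (#Y : ℝ) ≤ K := by exact_mod_cast hY
            gcongr
            linarith
        _ = β * n / 2 := by field_simp
    have h6 : (#(Z ∪ {x, y} ∪ Y.biUnion (fun l => ({v | E x v l} : Finset V)) ∪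
        Y.biUnion (fun l => ({v | E v y l} : Finset V))) : ℝ) ≤ #Z + 2 + #Y * 1 +
        #(Y.biUnion (fun l => ({v | E v y l} : Finset V))) := by
      norm_cast
      refine (card_union_le _ _).trans (Nat.add_le_add_right ((card_union_le _ _).trans
        (Nat.add_le_add ((card_union_le _ _).trans (Nat.add_le_add_left card_le_two _)) h4)) _)
    have h7 : (#Y : ℝ) ≤ K := by exact_mod_cast hY
    have h8 : (#Z : ℝ) ≤ K := by exact_mod_cast hZ
    have h9 : β * n ≤ ({v | ∃ l m, E x v l ∧ E v y m ∧ m ∉ conf l}.ncard : ℝ) := h2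
    have h10 : ({v | ∃ l m, E x v l ∧ E v y m ∧ m ∉ conf l}.ncard : ℝ) ≤
      #(Z ∪ {x, y} ∪ Y.biUnion (fun l => ({v | E x v l} : Finset V)) ∪
        Y.biUnion (fun l => ({v | E v y l} : Finset V))) := by exact_mod_cast h3
    linarith
  simp only [mem_union, mem_insert, mem_singleton, mem_biUnion, mem_filter, mem_univ, true_and,
    not_or, not_exists, not_and] at hv
  obtain ⟨⟨⟨hvZ, hvx, hvy⟩, hv1⟩, hv2⟩ := hv
  refine ⟨_, _, .snoc (.snoc .nil hl (by simp) hvx (by simp)) hm (by simpa using Ne.symm hvy)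
    hxy.symm (by simpa using hlm), card_le_two, card_le_two, ?_, ?_, empty_subset _⟩
  · rw [disjoint_left]
    intro a ha haY
    simp only [insert_empty_eq, mem_insert, mem_singleton] at ha
    obtain rfl | rfl := ha
    · exact hv2 _ haY hm
    · exact hv1 _ haY hl
  · rw [disjoint_left]
    intro a ha haZ
    simp only [insert_empty_eq, mem_insert, mem_singleton] at ha
    obtain rfl | rfl := ha
    · exact hyZ haZ
    · exact hvZ haZ

/-- Paths to `v` and on to `y` can be joined, if the first path takes care not to use a label that
conflicts with a heavy label at `y`. -/
theorem Linked.trans {V L : Type*} [Fintype L] [DecidableEq V] [DecidableEq L]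
    {E : V → V → L → Prop} {conf : L → Finset L} {e : ℕ} (hc : IsConflict conf e) {d d' : ℕ}
    {x v y : V} {T : Finset V} {Y : Finset L} {Z : Finset V} {t : ℝ}
    (hxy : x ≠ y) (hyZ : y ∉ Z) (hY : Disjoint (heavyLabels E t y) Y)
    (h : Linked E conf d x v T (Y ∪ (heavyLabels E t y).biUnion conf) (insert y Z))
    (h' : ∀ (Y' : Finset L) (Z' : Finset V), #Y' ≤ #Y + e * d → #Z' ≤ #Z + d + 1 →
      Disjoint (heavyLabels E t y) Y' → y ∉ Z' → Linked E conf d' v y ∅ Y' Z') :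
    Linked E conf (d + d') x y (insert v T) Y Z ∨ v = x := by
  obtain ⟨Zs, Ls, hp, hZs, hLs, hLY, hZZ, hT⟩ := h
  rw [disjoint_union_right] at hLY
  rw [disjoint_insert_right] at hZZ
  -- The first path avoids all conflicts with heavy labels at `y`. By symmetry its own conflicts
  -- contain no heavy label at `y`, so the second path may be asked to avoid them.
  obtain ⟨Zs', Ls', hp', hZs', hLs', hLY', hZZ', -⟩ := h' (Y ∪ Ls.biUnion conf) (insert x (Z ∪ Zs))
    ((card_union_le _ _).trans (Nat.add_le_add_left ((hc.card_biUnion_le _).trans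
      (Nat.mul_le_mul_left _ hLs)) _))
    ((card_insert_le _ _).trans (Nat.succ_le_succ ((card_union_le _ _).trans
      (Nat.add_le_add_left hZs _))))
    (disjoint_union_right.2 ⟨hY, hc.disjoint_biUnion_comm hLY.2⟩)
    (by simp [hxy.symm, hyZ, hZZ.1])
  rw [disjoint_union_right] at hLY'
  rw [disjoint_insert_right, disjoint_union_right] at hZZ'
  -- If the first path is empty, `v` is not a non-starting vertex; hence the alternative `v = x`.
  obtain hv | hv := hp.end_mem
  · exact Or.inr hv
  refine Or.inl ⟨_, _, hp.trans hp' ?_ ?_, (card_union_le _ _).trans (Nat.add_le_add hZs hZs'),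
    (card_union_le _ _).trans (Nat.add_le_add hLs hLs'), disjoint_union_left.2 ⟨hLY.1, hLY'.1⟩,
    disjoint_union_left.2 ⟨hZZ.2, hZZ'.2.1⟩, ?_⟩
  · exact fun z hz => ⟨disjoint_left.1 hZZ'.2.2 hz, fun h => hZZ'.1 (h ▸ hz)⟩
  · exact fun l hl m hm hlm => disjoint_left.1 hLY'.2 hl (mem_biUnion.2 ⟨m, hm, hlm⟩)
  · exact insert_subset (mem_union_left _ hv) (hT.trans subset_union_left)

theorem Linked.mono {V L : Type*} [DecidableEq V] [DecidableEq L]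
    {E : V → V → L → Prop} {conf : L → Finset L} {d d' : ℕ} {x y : V} {T T' : Finset V}
    {Y : Finset L} {Z : Finset V} (h : Linked E conf d x y T Y Z) (hd : d ≤ d') (hT : T' ⊆ T) :
    Linked E conf d' x y T' Y Z := by
  obtain ⟨Zs, Ls, hp, hZs, hLs, h1, h2, h3⟩ := h
  exact ⟨Zs, Ls, hp, hZs.trans hd, hLs.trans hd, h1, h2, hT.trans h3⟩

/-- Each level of `DenseReach` joins two paths at a middle vertex, which doubles the length. With
linearly many middle vertices, one can be chosen at which no label to be avoided is heavy. -/
theorem linked_of_denseReach (β β' : ℝ) (hβ : 0 < β) (hβ' : 0 < β') (e j : ℕ) : ∀ K : ℕ,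
    ∃ θ : ℝ, 0 < θ ∧ ∃ N : ℕ, ∀ {V L : Type*} [Fintype V] [Fintype L] [DecidableEq V]
      [DecidableEq L] (W : Finset V) (E : V → V → L → Prop) (conf : L → Finset L)
      (x y : V) (Y : Finset L) (Z : Finset V), IsOutLabelling W E → IsConflict conf e →
      N ≤ Fintype.card V → x ≠ y →
      DenseReach W (β' * Fintype.card V) (TwoStep E conf (β * Fintype.card V)) j x y →
      #Y ≤ K → #Z ≤ K → Disjoint (heavyLabels E (θ * Fintype.card V) y) Y → y ∉ Z →
      Linked E conf (2 ^ (j + 1)) x y ∅ Y Z := by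
  induction j with
  | zero =>
    intro K
    obtain ⟨θ, hθ, N, h⟩ := linked_of_twoStep β hβ K
    exact ⟨θ, hθ, N, fun W E conf x y Y Z hE _ hn hxy h2 hY hZ hd hy =>
      h W E conf x y Y Z hE hn hxy h2 hY hZ hd hy⟩
  | succ j ih =>
    intro K
    obtain ⟨d, hd⟩ : ∃ d, 2 ^ (j + 1) = d := ⟨_, rfl⟩
    have hd2 : 2 ^ (j + 1 + 1) = d + d := by rw [← hd]; ring
    simp only [hd] at ih
    simp only [hd2]
    -- The constants of the second half come first: it has to avoid the conflicts and vertices of a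
    -- first half of length `d`. Its threshold `θ₂` bounds by `M` the heavy labels at `y`, whose
    -- conflicts the first half must avoid.
    obtain ⟨θ₂, hθ₂, N₂, h₂⟩ := ih (K + e * d + d + 1)
    obtain ⟨M, hM⟩ := exists_nat_ge (1 / θ₂)
    obtain ⟨θ₁, hθ₁, N₁, h₁⟩ := ih (K + e * M + 1)
    obtain ⟨N₃, hN₃⟩ := exists_nat_gt ((K + 2 + (K + e * M) * (1 / θ₁)) / β')
    refine ⟨θ₂, hθ₂, N₁ + N₂ + N₃, ?_⟩
    intro V L _ _ _ _ W E conf x y Y Z hE hc hn hxy h hY hZ hyd hy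
    obtain h | h := h
    · exact (h₂ W E conf x y Y Z hE hc (by omega) hxy h (by omega) (by omega) hyd hy).mono
        (by omega) subset_rfl
    classical
    have hn₃ : K + 2 + (K + e * M) * (1 / θ₁) < β' * Fintype.card V := by
      have h3 : (N₃ : ℝ) ≤ Fintype.card V := by
        exact_mod_cast (show N₃ ≤ Fintype.card V by omega)
      rw [div_lt_iff₀ hβ'] at hN₃
      nlinarith
    have hV : 0 < Fintype.card V := Fintype.card_pos_iff.2 ⟨x⟩
    set H := heavyLabels E (θ₂ * Fintype.card V) y with hH
    have hHM : #H ≤ M := by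
      have := (card_heavyLabels_le hE θ₂ hθ₂ hV y).trans hM
      exact_mod_cast this
    have hYH : #(Y ∪ H.biUnion conf) ≤ K + e * M :=
      (card_union_le _ _).trans (Nat.add_le_add hY ((hc.card_biUnion_le _).trans
        (Nat.mul_le_mul_left _ hHM)))
    -- Each of the boundedly many labels to be avoided is heavy at no more than `1 / θ₁` vertices,
    -- so only boundedly many middle vertices are excluded.
    obtain ⟨v, ⟨-, hv1, hv2⟩, hv⟩ : ∃ v ∈ {v | v ∈ W ∧
        DenseReach W (β' * Fintype.card V) (TwoStep E conf (β * Fintype.card V)) j x v ∧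
        DenseReach W (β' * Fintype.card V) (TwoStep E conf (β * Fintype.card V)) j v y},
        v ∉ Z ∪ {x, y} ∪ (Y ∪ H.biUnion conf).biUnion (fun l =>
          {v | l ∈ heavyLabels E (θ₁ * Fintype.card V) v}) := by
      by_contra! hcon
      have h3 := Set.ncard_le_ncard (show {v | v ∈ W ∧
        DenseReach W (β' * Fintype.card V) (TwoStep E conf (β * Fintype.card V)) j x v ∧
        DenseReach W (β' * Fintype.card V) (TwoStep E conf (β * Fintype.card V)) j v y} ⊆
        ↑(Z ∪ {x, y} ∪ (Y ∪ H.biUnion conf).biUnion (fun l =>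
          {v | l ∈ heavyLabels E (θ₁ * Fintype.card V) v})) from fun v hv => hcon v hv)
      rw [Set.ncard_coe_finset] at h3
      have h5 : (#((Y ∪ H.biUnion conf).biUnion (fun l =>
          ({v | l ∈ heavyLabels E (θ₁ * Fintype.card V) v} : Finset V))) : ℝ) ≤
          (K + e * M) * (1 / θ₁) := by
        calc _ ≤ ∑ l ∈ Y ∪ H.biUnion conf,
              (#({v | l ∈ heavyLabels E (θ₁ * Fintype.card V) v} : Finset V) : ℝ) := by
              exact_mod_cast card_biUnion_le
          _ ≤ ∑ l ∈ Y ∪ H.biUnion conf, 1 / θ₁ :=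
              sum_le_sum fun l _ => by
                refine le_trans (le_of_eq ?_) (card_heavy_at_le hE θ₁ hθ₁ hV l)
                congr!
          _ = #(Y ∪ H.biUnion conf) * (1 / θ₁) := by rw [sum_const, nsmul_eq_mul]
          _ ≤ _ := by
              have : (#(Y ∪ H.biUnion conf) : ℝ) ≤ K + e * M := by exact_mod_cast hYH
              gcongr
      have h6 : (#(Z ∪ {x, y} ∪ (Y ∪ H.biUnion conf).biUnion (fun l =>
          ({v | l ∈ heavyLabels E (θ₁ * Fintype.card V) v} : Finset V))) : ℝ) ≤ #Z + 2 +
          #((Y ∪ H.biUnion conf).biUnion (fun l =>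
          ({v | l ∈ heavyLabels E (θ₁ * Fintype.card V) v} : Finset V))) := by
        norm_cast
        exact (card_union_le _ _).trans (Nat.add_le_add_right ((card_union_le _ _).trans
          (Nat.add_le_add_left card_le_two _)) _)
      have h8 : (#Z : ℝ) ≤ K := by exact_mod_cast hZ
      have h10 := h.trans (Nat.cast_le.2 h3)
      linarith
    simp only [mem_union, mem_insert, mem_singleton, mem_biUnion, mem_filter, mem_univ, true_and,
      not_or, not_exists, not_and] at hv
    obtain ⟨⟨hvZ, hvx, hvy⟩, hvl⟩ := hv
    have hfirst : Linked E conf d x v ∅ (Y ∪ H.biUnion conf) (insert y Z) := by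
      refine h₁ W E conf x v _ _ hE hc (by omega) (Ne.symm hvx) hv1 (by omega)
        ((card_insert_le _ _).trans (by omega)) ?_ (by simp [hvZ, hvy])
      rw [disjoint_right]
      intro l hl
      exact hvl l (by simpa using hl)
    obtain h | h := Linked.trans hc hxy hy hyd hfirst (fun Y' Z' hY' hZ' hd' hy' =>
      h₂ W E conf v y Y' Z' hE hc (by omega) hvy hv2 (by omega) (by omega) hd' hy')
    · exact h.mono le_rfl (empty_subset _)
    · exact absurd h hvx

/-- In a set of vertices that are pairwise related by `DenseReach`, boundedly many vertices can
be joined by a path, provided that their heavy labels do not conflict. -/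
theorem linked_through (β β' : ℝ) (hβ : 0 < β) (hβ' : 0 < β') (e J t : ℕ) : ∀ K : ℕ,
    ∃ θ : ℝ, 0 < θ ∧ ∃ N : ℕ, ∀ {V L : Type*} [Fintype V] [Fintype L] [DecidableEq V]
      [DecidableEq L] (W C : Finset V) (E : V → V → L → Prop) (conf : L → Finset L)
      (x y : V) (T : Finset V) (Y : Finset L) (Z : Finset V),
      IsOutLabelling W E → IsConflict conf e → N ≤ Fintype.card V →
      (∀ a ∈ C, ∀ b ∈ C,
        DenseReach W (β' * Fintype.card V) (TwoStep E conf (β * Fintype.card V)) J a b) →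
      x ∈ C → y ∈ C → T ⊆ C → x ≠ y → x ∉ T → y ∉ T → #T ≤ t →
      #Y ≤ K → #Z ≤ K →
      (∀ a ∈ insert y T, Disjoint (heavyLabels E (θ * Fintype.card V) a) Y ∧ a ∉ Z) →
      (∀ a ∈ insert y T, ∀ b ∈ insert y T, a ≠ b →
        Disjoint (heavyLabels E (θ * Fintype.card V) a)
          ((heavyLabels E (θ * Fintype.card V) b).biUnion conf)) →
      Linked E conf ((t + 1) * 2 ^ (J + 1)) x y T Y Z := by
  induction t with
  | zero =>
    intro K
    obtain ⟨θ, hθ, N, h⟩ := linked_of_denseReach β β' hβ hβ' e J K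
    refine ⟨θ, hθ, N, ?_⟩
    intro V L _ _ _ _ W C E conf x y T Y Z hE hc hn hC hx hy _ hxy _ _ hT hY hZ ha _
    obtain rfl : T = ∅ := card_eq_zero.1 (by omega)
    exact (h W E conf x y Y Z hE hc hn hxy (hC x hx y hy) hY hZ (ha y (by simp)).1
      (ha y (by simp)).2).mono (by omega) subset_rfl
  | succ t ih =>
    intro K
    set d := (t + 1) * 2 ^ (J + 1) with hd
    obtain ⟨θ₂, hθ₂, N₂, h₂⟩ := linked_of_denseReach β β' hβ hβ' e J (K + e * d + d + 1)
    obtain ⟨M, hM⟩ := exists_nat_ge (1 / θ₂)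
    obtain ⟨θ₁, hθ₁, N₁, h₁⟩ := ih (K + e * M + 1)
    refine ⟨min θ₁ θ₂, lt_min hθ₁ hθ₂, N₁ + N₂, ?_⟩
    intro V L _ _ _ _ W C E conf x y T Y Z hE hc hn hC hx hy hTC hxy hxT hyT hT hY hZ ha hab
    have hV : 0 < Fintype.card V := Fintype.card_pos_iff.2 ⟨x⟩
    have hsub₁ : ∀ a, heavyLabels E (θ₁ * Fintype.card V) a ⊆
        heavyLabels E (min θ₁ θ₂ * Fintype.card V) a := fun a =>
      heavyLabels_anti (by gcongr; exact min_le_left _ _) a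
    have hsub₂ : ∀ a, heavyLabels E (θ₂ * Fintype.card V) a ⊆
        heavyLabels E (min θ₁ θ₂ * Fintype.card V) a := fun a =>
      heavyLabels_anti (by gcongr; exact min_le_right _ _) a
    have hyY := disjoint_of_subset_left (hsub₂ y) (ha y (by simp)).1
    have hyZ := (ha y (by simp)).2
    have hdle : (t + 1 + 1) * 2 ^ (J + 1) = d + 2 ^ (J + 1) := by rw [hd]; ring
    obtain rfl | ⟨c, hcT⟩ := T.eq_empty_or_nonempty
    · exact (h₂ W E conf x y Y Z hE hc (by omega) hxy (hC x hx y hy) (by omega) (by omega) hyY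
        hyZ).mono (by omega) subset_rfl
    have hcy : c ≠ y := fun h => hyT (h ▸ hcT)
    have hcx : c ≠ x := fun h => hxT (h ▸ hcT)
    set H := heavyLabels E (θ₂ * Fintype.card V) y with hH
    have hHM : #H ≤ M := by
      have := (card_heavyLabels_le hE θ₂ hθ₂ hV y).trans hM
      exact_mod_cast this
    have hYH : #(Y ∪ H.biUnion conf) ≤ K + e * M :=
      (card_union_le _ _).trans (Nat.add_le_add hY ((hc.card_biUnion_le _).trans
        (Nat.mul_le_mul_left _ hHM)))
    have hcT' : insert c (T.erase c) = T := insert_erase hcT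
    -- Some `c ∈ T` is split off: the first part runs through the rest of `T` and ends at `c`, and
    -- the last part runs from `c` to `y`.
    have hfirst : Linked E conf d x c (T.erase c) (Y ∪ H.biUnion conf) (insert y Z) := by
      refine h₁ W C E conf x c _ _ _ hE hc (by omega) hC hx (hTC hcT)
        ((erase_subset _ _).trans hTC) hcx.symm (fun h => hxT (mem_of_mem_erase h))
        (notMem_erase _ _) (by rw [card_erase_of_mem hcT]; omega) (by omega)
        ((card_insert_le _ _).trans (by omega)) ?_ ?_
      · rw [hcT']
        intro a haT
        have hay : a ≠ y := fun h => hyT (h ▸ haT)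
        refine ⟨disjoint_union_right.2 ⟨disjoint_of_subset_left (hsub₁ a)
          (ha a (mem_insert_of_mem haT)).1, ?_⟩, ?_⟩
        · exact disjoint_of_subset_left (hsub₁ a) (disjoint_of_subset_right
            (biUnion_subset_biUnion_of_subset_left _ (hsub₂ y))
            (hab a (mem_insert_of_mem haT) y (mem_insert_self _ _) hay))
        · rw [mem_insert, not_or]
          exact ⟨hay, (ha a (mem_insert_of_mem haT)).2⟩
      · rw [hcT']
        intro a haT b hbT hne
        exact disjoint_of_subset_left (hsub₁ a) (disjoint_of_subset_right
            (biUnion_subset_biUnion_of_subset_left _ (hsub₁ b))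
            (hab a (mem_insert_of_mem haT) b (mem_insert_of_mem hbT) hne))
    obtain h | h := Linked.trans hc hxy hyZ hyY hfirst (fun Y' Z' hY' hZ' hd' hy' =>
      h₂ W E conf c y Y' Z' hE hc (by omega) hcy (hC c (hTC hcT) y hy) (by omega) (by omega)
        hd' hy')
    · rw [hcT'] at h
      exact h.mono (by omega) subset_rfl
    · exact absurd h hcx

/-- There are at least `γn · γn/2` pairs consisting of a middle vertex and an endpoint. Endpoints
with few middle vertices account for at most `γ²n²/4` of them, and any other endpoint for at most
`n`. -/
theorem card_twoStep_ge {V L : Type*} [Fintype V] [DecidableEq V] [DecidableEq L]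
    {W : Finset V} {E : V → V → L → Prop} {conf : L → Finset L} {e : ℕ}
    (hE : IsOutLabelling W E) (hc : IsConflict conf e) {γ : ℝ} (hγ : 0 < γ)
    (he : (e : ℝ) ≤ γ / 2 * Fintype.card V)
    (hdeg : ∀ x ∈ W, γ * Fintype.card V ≤ ({v | ∃ l, E x v l}.ncard : ℝ)) {x : V} (hx : x ∈ W) :
    γ ^ 2 / 4 * Fintype.card V ≤
      ({y | y ∈ W ∧ TwoStep E conf (γ ^ 2 / 4 * Fintype.card V) x y}.ncard : ℝ) := by
  classical
  have hV : (0 : ℝ) < Fintype.card V := by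
    exact_mod_cast Fintype.card_pos_iff.2 ⟨x⟩
  set n : ℝ := ((Fintype.card V : ℕ) : ℝ) with hn
  set r : V → V → Prop := fun v y => ∃ l m, E x v l ∧ E v y m ∧ m ∉ conf l with hr
  obtain ⟨B, hB⟩ : ∃ B : Finset V, B = ({v | ∃ l, E x v l} : Finset V) := ⟨_, rfl⟩
  have hBcard : γ * n ≤ #B := by
    refine (hdeg x hx).trans (le_of_eq ?_)
    rw [← Set.ncard_coe_finset, hB]; simp
  have hBn : (#B : ℝ) ≤ n := by rw [hn]; exact_mod_cast card_le_univ B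
  have hlow : ∀ v ∈ B, γ / 2 * n ≤ (#{y | r v y} : ℝ) := by
    intro v hv
    obtain ⟨l, hl⟩ : ∃ l, E x v l := by simpa [hB] using hv
    have h1 := hdeg v (hE.head_mem hl)
    have h2 : ({v_1 | ∃ m, E v v_1 m} : Set V) ⊆
        ↑(({y | r v y} : Finset V) ∪ (conf l).biUnion fun m => ({y | E v y m} : Finset V)) := by
      rintro y ⟨m, hm⟩
      simp only [coe_union, Set.mem_union, mem_coe, mem_filter, mem_univ, true_and, mem_biUnion]
      by_cases h : m ∈ conf l
      · exact Or.inr ⟨m, h, hm⟩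
      · exact Or.inl ⟨l, m, hl, hm, h⟩
    have h3 := Set.ncard_le_ncard h2
    rw [Set.ncard_coe_finset] at h3
    have h4 : #((conf l).biUnion fun m => ({y | E v y m} : Finset V)) ≤ #(conf l) * 1 :=
      card_biUnion_le_card_mul _ _ _ fun l _ => card_le_one.2 fun a ha b hb =>
        hE.head_unique (mem_filter.1 ha).2 (mem_filter.1 hb).2
    have h5 : {v_1 | ∃ m, E v v_1 m}.ncard ≤ #{y | r v y} + e :=
      h3.trans ((card_union_le _ _).trans (Nat.add_le_add_left
        (h4.trans (by rw [mul_one]; exact hc.card_le l)) _))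
    have h6 : ({v_1 | ∃ m, E v v_1 m}.ncard : ℝ) ≤ #{y | r v y} + e := by exact_mod_cast h5
    linarith
  have hsum : ∑ v ∈ B, (#{y | r v y} : ℝ) = ∑ y : V, (#{v ∈ B | r v y} : ℝ) := by
    have := sum_card_bipartiteAbove_eq_sum_card_bipartiteBelow (s := B) (t := (univ : Finset V)) r
    simp only [bipartiteAbove, bipartiteBelow] at this
    exact_mod_cast this
  have hlow' : γ * n * (γ / 2 * n) ≤ ∑ v ∈ B, (#{y | r v y} : ℝ) := by
    calc γ * n * (γ / 2 * n) ≤ #B * (γ / 2 * n) := by gcongr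
      _ = ∑ v ∈ B, γ / 2 * n := by rw [sum_const, nsmul_eq_mul]
      _ ≤ _ := sum_le_sum hlow
  obtain ⟨G, hG⟩ : ∃ G : Finset V,
      G = ({y | TwoStep E conf (γ ^ 2 / 4 * n) x y} : Finset V) := ⟨_, rfl⟩
  have hup : ∑ y : V, (#{v ∈ B | r v y} : ℝ) ≤ ∑ y : V, ((if y ∈ G then n else 0) +
      γ ^ 2 / 4 * n) := by
    refine sum_le_sum fun y _ => ?_
    split_ifs with hy
    · have : (#{v ∈ B | r v y} : ℝ) ≤ #B := by exact_mod_cast card_le_card (filter_subset _ _)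
      have : 0 < γ ^ 2 / 4 * n := by positivity
      linarith
    · rw [hG, mem_filter, not_and, TwoStep, not_le] at hy
      have h1 := hy (mem_univ y)
      have h2 : #{v ∈ B | r v y} ≤ {v | ∃ l m, E x v l ∧ E v y m ∧ m ∉ conf l}.ncard := by
        rw [← Set.ncard_coe_finset]
        refine Set.ncard_le_ncard fun v hv => ?_
        exact (mem_filter.1 hv).2
      have h3 : (#{v ∈ B | r v y} : ℝ) ≤
        ({v | ∃ l m, E x v l ∧ E v y m ∧ m ∉ conf l}.ncard : ℝ) := by exact_mod_cast h2
      linarith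
  rw [sum_add_distrib, sum_ite_mem, univ_inter, sum_const, sum_const, nsmul_eq_mul, nsmul_eq_mul,
    card_univ, ← hn] at hup
  have hfin : γ ^ 2 / 4 * n * n ≤ #G * n := by nlinarith
  have hsub : (↑G : Set V) ⊆ {y | y ∈ W ∧ TwoStep E conf (γ ^ 2 / 4 * n) x y} := by
    intro y hy
    have hy' : TwoStep E conf (γ ^ 2 / 4 * n) x y := by
      rw [hG] at hy; exact (mem_filter.1 hy).2
    refine ⟨?_, hy'⟩
    have hpos : 0 < ({v | ∃ l m, E x v l ∧ E v y m ∧ m ∉ conf l}.ncard : ℝ) :=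
      lt_of_lt_of_le (by positivity) hy'
    obtain ⟨v, l, m, -, hm, -⟩ := Set.nonempty_of_ncard_ne_zero
      (by exact_mod_cast hpos.ne' : {v | ∃ l m, E x v l ∧ E v y m ∧ m ∉ conf l}.ncard ≠ 0)
    exact hE.head_mem hm
  have h1 := Set.ncard_le_ncard hsub (Set.toFinite _)
  rw [Set.ncard_coe_finset] at h1
  exact (le_of_mul_le_mul_right hfin hV).trans (by exact_mod_cast h1)

/-- An out-labelling of large minimum degree has a large set of vertices that are linked with
each other by short conflict-free paths. -/
theorem exists_linked_core (γ : ℝ) (hγ : 0 < γ) (hγ1 : γ ≤ 1) :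
    ∃ δ : ℝ, 0 < δ ∧ ∃ d : ℕ, ∀ e t K : ℕ, ∃ θ : ℝ, 0 < θ ∧ ∃ N : ℕ,
      ∀ {V L : Type*} [Fintype V] [Fintype L] [DecidableEq V] [DecidableEq L]
        (W : Finset V) (E : V → V → L → Prop) (conf : L → Finset L),
        IsOutLabelling W E → IsConflict conf e → N ≤ Fintype.card V → W.Nonempty →
        (∀ x ∈ W, γ * Fintype.card V ≤ ({v | ∃ l, E x v l}.ncard : ℝ)) →
        ∃ C ⊆ W, δ * Fintype.card V ≤ (#C : ℝ) ∧
          ∀ (x y : V) (T : Finset V) (Y : Finset L) (Z : Finset V),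
          x ∈ C → y ∈ C → T ⊆ C → x ≠ y → x ∉ T → y ∉ T → #T ≤ t → #Y ≤ K → #Z ≤ K →
          (∀ a ∈ insert y T, Disjoint (heavyLabels E (θ * Fintype.card V) a) Y ∧ a ∉ Z) →
          (∀ a ∈ insert y T, ∀ b ∈ insert y T, a ≠ b →
            Disjoint (heavyLabels E (θ * Fintype.card V) a)
              ((heavyLabels E (θ * Fintype.card V) b).biUnion conf)) →
          Linked E conf ((t + 1) * d) x y T Y Z := by
  obtain ⟨J, β', hβ', hcore⟩ := exists_core (γ ^ 2 / 4) (by positivity) (by nlinarith)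
  -- The core size and the segment length are fixed before `e`, `t`, `K`. This order is needed when
  -- hubs are iterated, where `e` depends on the path length demanded of the previous hub.
  refine ⟨γ ^ 2 / 4 / 2, by positivity, 2 ^ (J + 1), ?_⟩
  intro e t K
  obtain ⟨θ, hθ, N, h⟩ := linked_through (γ ^ 2 / 4) β' (by positivity) hβ' e J t K
  obtain ⟨N', hN'⟩ := exists_nat_gt (e / (γ / 2))
  refine ⟨θ, hθ, N + N', ?_⟩
  intro V L _ _ _ _ W E conf hE hc hn hW hdeg
  have hV : (0 : ℝ) < Fintype.card V := by
    exact_mod_cast Fintype.card_pos_iff.2 ⟨hW.choose⟩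
  have he : (e : ℝ) ≤ γ / 2 * Fintype.card V := by
    have h3 : (N' : ℝ) ≤ Fintype.card V := by
      exact_mod_cast (show N' ≤ Fintype.card V by omega)
    rw [div_lt_iff₀ (by positivity)] at hN'
    nlinarith
  obtain ⟨C, hCW, hC, hCC⟩ := hcore W (TwoStep E conf (γ ^ 2 / 4 * Fintype.card V))
    (Fintype.card V) hV (by exact_mod_cast card_le_univ W) hW
    (fun x hx => card_twoStep_ge hE hc hγ he hdeg hx)
  exact ⟨C, hCW, hC, fun x y T Y Z hx hy hT hxy hxT hyT hTt hY hZ h1 h2 =>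
    h W C E conf x y T Y Z hE hc (by omega) hCC hx hy hT hxy hxT hyT hTt hY hZ h1 h2⟩

/-! ### Conflicts induced by sets of labels -/

/-- The labels that share, up to a conflict, an element of `F` with `a`. -/
def pullConflict {L : Type*} [Fintype L] [DecidableEq L] (conf : L → Finset L) (F : L → Finset L)
    (a : L) : Finset L :=
  insert a ({b | ∃ f ∈ F b, f ∈ (F a).biUnion conf} : Finset L)

theorem card_filter_meets_le {L : Type*} [Fintype L] [DecidableEq L] {F : L → Finset L} {M : ℕ}
    (hF : ∀ f, #{b | f ∈ F b} ≤ M) (B : Finset L) : #{b | ∃ f ∈ F b, f ∈ B} ≤ #B * M := by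
  refine le_trans (card_le_card ?_) (card_biUnion_le_card_mul B (fun f => {b | f ∈ F b}) M
    fun f _ => hF f)
  intro b hb
  obtain ⟨f, hf, hfB⟩ := (mem_filter.1 hb).2
  exact mem_biUnion.2 ⟨f, hfB, by simpa using hf⟩

theorem IsConflict.pull {L : Type*} [Fintype L] [DecidableEq L] {conf : L → Finset L} {e M : ℕ}
    (hc : IsConflict conf e) {F : L → Finset L} (hF : ∀ f, #{b | f ∈ F b} ≤ M)
    (hF' : ∀ a, #(F a) ≤ M) : IsConflict (pullConflict conf F) (e * M * M + 1) where
  refl l := mem_insert_self _ _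
  symm {l m} h := by
    simp only [pullConflict, mem_insert, mem_filter, mem_univ, true_and, mem_biUnion] at h ⊢
    obtain h | ⟨f, hf, g, hg, hfg⟩ := h
    · exact Or.inl h.symm
    · exact Or.inr ⟨g, hg, f, hf, hc.symm hfg⟩
  card_le a := by
    refine (card_insert_le _ _).trans (Nat.succ_le_succ ((card_filter_meets_le hF _).trans ?_))
    gcongr
    exact (hc.card_biUnion_le _).trans (Nat.mul_le_mul_left _ (hF' a))

/-! ### Switching trails -/

namespace LabelledDigraph

variable {V X : Type*} {D : LabelledDigraph V X}

theorem HasLabel.unique {x y : V} {l m : V ⊕ X} (h : D.HasLabel x y l) (h' : D.HasLabel x y m) :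
    l = m := by
  obtain ⟨_, rfl⟩ := h
  obtain ⟨_, rfl⟩ := h'
  rfl

/-- Switching paths from `u`, together with the set of non-starting vertices and the set of
labels. -/
inductive SwitchingTrail [DecidableEq V] [DecidableEq X] (D : LabelledDigraph V X) (u : V) :
    V → Finset V → Finset (V ⊕ X) → Prop
  | nil : SwitchingTrail D u u ∅ ∅
  | snoc {y z : V} {Zs : Finset V} {Ls : Finset (V ⊕ X)} {l : V ⊕ X} :
      SwitchingTrail D u y Zs Ls → D.HasLabel y z l → z ∉ Zs → z ≠ u → l ∉ Ls →
      (∀ c, l = Sum.inl c → c ∈ Zs) → SwitchingTrail D u z (insert z Zs) (insert l Ls)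

namespace SwitchingTrail

variable [DecidableEq V] [DecidableEq X] {u v w : V} {Zs Zs' : Finset V}
  {Ls Ls' : Finset (V ⊕ X)}

theorem mem_of_inl_mem (h : D.SwitchingTrail u v Zs Ls) {c : V} (hc : Sum.inl c ∈ Ls) :
    c ∈ Zs := by
  induction h with
  | nil => simp at hc
  | snoc _ _ _ _ _ hl ih =>
    obtain h | h := mem_insert.1 hc
    · exact mem_insert_of_mem (hl c h.symm)
    · exact mem_insert_of_mem (ih h)

/-- The vertex labels of the appended path are all visited by the first trail, so the order in which
they occur does not matter. -/
theorem append {E : V → V → V ⊕ X → Prop} {conf : V ⊕ X → Finset (V ⊕ X)}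
    (hconf : ∀ l, l ∈ conf l) (hE : ∀ x y l, E x y l → D.HasLabel x y l)
    (h : D.SwitchingTrail u w Zs Ls) (h' : ConflictFreePath E conf w v Zs' Ls')
    (hZ : ∀ z ∈ Zs', z ∉ Zs ∧ z ≠ u) (hL : Disjoint Ls Ls')
    (hc : ∀ c, Sum.inl c ∈ Ls' → c ∈ Zs) :
    D.SwitchingTrail u v (Zs ∪ Zs') (Ls ∪ Ls') := by
  induction h' with
  | nil => simpa using h
  | @snoc a b A B l _ he hb _ hl ih =>
    rw [union_insert, union_insert]
    rw [disjoint_insert_right] at hL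
    have hb' := hZ b (mem_insert_self _ _)
    refine .snoc (ih (fun z hz => hZ z (mem_insert_of_mem hz)) hL.2
      fun c h => hc c (mem_insert_of_mem h)) (hE _ _ _ he) ?_ hb'.2 ?_ ?_
    · rw [mem_union, not_or]
      exact ⟨hb'.1, hb⟩
    · rw [mem_union, not_or]
      exact ⟨hL.1, fun h => hl l h (hconf l)⟩
    · rintro c rfl
      exact mem_union_left _ (hc c (mem_insert_self _ _))

theorem exists_isSwitchingPath (h : D.SwitchingTrail u v Zs Ls) :
    ∃ (d : ℕ) (p : ℕ → V), D.IsSwitchingPath p d ∧ p 0 = u ∧ p d = v ∧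
      (∀ i ≤ d, p i = u ∨ p i ∈ Zs) ∧ (∀ c ∈ Zs, ∃ j, 1 ≤ j ∧ j ≤ d ∧ p j = c) ∧
      (∀ i < d, ∀ l, D.HasLabel (p i) (p (i + 1)) l → l ∈ Ls) := by
  induction h with
  | nil =>
    refine ⟨0, fun _ => u, ⟨?_, ?_, ?_, ?_⟩, rfl, rfl, ?_, ?_, ?_⟩ <;> simp
  | @snoc y z A B l _ he hz hzu hl hlc ih =>
    obtain ⟨d, p, hp, h0, hd, hA, hA', hB⟩ := ih
    obtain ⟨q, hq⟩ : ∃ q : ℕ → V, q = fun i => if i ≤ d then p i else z := ⟨_, rfl⟩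
    have hq1 : ∀ i ≤ d, q i = p i := fun i hi => by rw [hq]; exact if_pos hi
    have hq2 : q (d + 1) = z := by rw [hq]; exact if_neg (by omega)
    have hpz : ∀ i ≤ d, p i ≠ z := by
      rintro i hi rfl
      exact (hA i hi).elim hzu hz
    have hstep : ∀ i < d + 1, ∀ m, D.HasLabel (q i) (q (i + 1)) m →
        (i < d ∧ D.HasLabel (p i) (p (i + 1)) m) ∨ (i = d ∧ m = l) := by
      intro i hi m hm
      obtain hi' | rfl := Nat.lt_succ_iff_lt_or_eq.1 hi
      · rw [hq1 i hi'.le, hq1 (i + 1) hi'] at hm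
        exact Or.inl ⟨hi', hm⟩
      · rw [hq1 i le_rfl, hq2, hd] at hm
        exact Or.inr ⟨rfl, hm.unique he⟩
    refine ⟨d + 1, q, ⟨?_, ?_, ?_, ?_⟩, ?_, hq2, ?_, ?_, ?_⟩
    · intro i hi j hj hij
      obtain hi | rfl := Nat.le_succ_iff.1 hi <;> obtain hj | rfl := Nat.le_succ_iff.1 hj
      · rw [hq1 i hi, hq1 j hj] at hij
        exact hp.distinct i hi j hj hij
      · rw [hq1 i hi, hq2] at hij
        exact absurd hij (hpz i hi)
      · rw [hq1 j hj, hq2] at hij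
        exact absurd hij.symm (hpz j hj)
      · rfl
    · intro i hi
      obtain hi' | rfl := Nat.lt_succ_iff_lt_or_eq.1 hi
      · rw [hq1 i hi'.le, hq1 (i + 1) hi']
        exact hp.adj i hi'
      · rw [hq1 i le_rfl, hq2, hd]
        exact he.choose
    · intro i hi j hj m hm hm'
      obtain ⟨hi, h1⟩ | ⟨hi, h1⟩ := hstep i hi m hm <;>
        obtain ⟨hj, h2⟩ | ⟨hj, h2⟩ := hstep j hj m hm'
      · exact hp.rainbow i hi j hj m h1 h2
      · exact absurd (hB i hi m h1) (h2 ▸ hl)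
      · exact absurd (hB j hj m h2) (h1 ▸ hl)
      · rw [hi, hj]
    · intro i hi c hc
      obtain ⟨hi, h1⟩ | ⟨rfl, h1⟩ := hstep i hi _ hc
      · obtain ⟨j, hj1, hj2, hj3⟩ := hp.consistent i hi c h1
        exact ⟨j, hj1, hj2, by rw [hq1 j (by omega), hj3]⟩
      · obtain ⟨j, hj1, hj2, hj3⟩ := hA' c (hlc c h1.symm)
        exact ⟨j, hj1, hj2, by rw [hq1 j hj2, hj3]⟩
    · rw [hq1 0 (Nat.zero_le d), h0]
    · intro i hi
      obtain hi | rfl := Nat.le_succ_iff.1 hi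
      · rw [hq1 i hi]
        exact (hA i hi).imp_right (mem_insert_of_mem)
      · rw [hq2]
        exact Or.inr (mem_insert_self _ _)
    · intro c hc
      obtain rfl | hc := mem_insert.1 hc
      · exact ⟨d + 1, by omega, le_rfl, hq2⟩
      · obtain ⟨j, hj1, hj2, hj3⟩ := hA' c hc
        exact ⟨j, hj1, by omega, by rw [hq1 j hj2, hj3]⟩
    · intro i hi m hm
      obtain ⟨hi, h1⟩ | ⟨-, rfl⟩ := hstep i hi m hm
      · exact mem_insert_of_mem (hB i hi m h1)
      · exact mem_insert_self _ _

theorem amidst (h : D.SwitchingTrail u v Zs Ls) {l : V ⊕ X} (hl : l ∉ Ls)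
    (hc : ∀ c, l = Sum.inl c → c ∈ Zs) : D.Amidst u v l := by
  obtain ⟨d, p, hp, h0, hd, -, h1, h2⟩ := h.exists_isSwitchingPath
  exact ⟨d, p, hp, h0, hd, fun i hi h => hl (h2 i hi l h), fun c h => h1 c (hc c h)⟩

end SwitchingTrail

end LabelledDigraph

/-! ### Hubs and their extension -/

namespace LabelledDigraph

section

variable {V X : Type*} [DecidableEq V]

/-- The set `F c` for the vertices `c` of `C`, and the singleton for all other labels. -/
def extendBySingleton (C : Finset V) (F : V → Finset (V ⊕ X)) : V ⊕ X → Finset (V ⊕ X) :=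
  Sum.elim (fun c => if c ∈ C then F c else {Sum.inl c}) (fun x => {Sum.inr x})

theorem extendBySingleton_of_mem {C : Finset V} {F : V → Finset (V ⊕ X)} {c : V} (hc : c ∈ C) :
    extendBySingleton C F (Sum.inl c) = F c := by
  simp [extendBySingleton, hc]

theorem extendBySingleton_of_notMem {C : Finset V} {F : V → Finset (V ⊕ X)} {l : V ⊕ X}
    (hl : ∀ c, l = Sum.inl c → c ∉ C) : extendBySingleton C F l = {l} := by
  cases l with
  | inl c => simp [extendBySingleton, hl c rfl]
  | inr x => rfl

theorem card_extendBySingleton_le {C : Finset V} {F : V → Finset (V ⊕ X)} {M : ℕ}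
    (hF : ∀ c, #(F c) ≤ M) (l : V ⊕ X) : #(extendBySingleton C F l) ≤ M + 1 := by
  cases l with
  | inl c =>
    by_cases hc : c ∈ C
    · rw [extendBySingleton_of_mem hc]
      exact (hF c).trans (Nat.le_succ M)
    · simp [extendBySingleton, hc]
  | inr x => simp [extendBySingleton]

end

variable {V X : Type*} [DecidableEq V] [DecidableEq X] {D : LabelledDigraph V X}

/-- The edges whose label is a non-vertex label or in `U`, not in `E`, and whose head is neither
in `U` nor in `E`. -/
def HubEdge (D : LabelledDigraph V X) (U : Finset V) (E : Finset (V ⊕ X)) (x y : V)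
    (l : V ⊕ X) : Prop :=
  D.HasLabel x y l ∧ (∀ c, l = Sum.inl c → c ∈ U) ∧ l ∉ E ∧ y ∉ U ∧ Sum.inl y ∉ E

/-- The vertex `w` is a hub for `U`: any `k` conflict-free labels from `U` and the non-vertex
labels, outside the small set `E`, can be made available simultaneously by a switching path from
`u` to `w`, and this path can be chosen to avoid any `k` vertices outside `U` and `E`. -/
structure IsHub (D : LabelledDigraph V X) (u w : V) (k e : ℕ) (U : Finset V)
    (E : Finset (V ⊕ X)) (conf : V ⊕ X → Finset (V ⊕ X)) : Prop where
  conflict : IsConflict conf e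
  start_mem : Sum.inl u ∈ E
  root_mem : Sum.inl w ∈ E
  card_le : #E ≤ e
  route : ∀ (S : Finset (V ⊕ X)) (Z : Finset V), #S ≤ k → #Z ≤ k →
    (∀ c, Sum.inl c ∈ S → c ∈ U) → Disjoint S E → (∀ a ∈ S, ∀ b ∈ S, a ≠ b → b ∉ conf a) →
    (∀ z ∈ Z, z ∉ U ∧ Sum.inl z ∉ E) →
    ∃ Zs Ls, D.SwitchingTrail u w Zs Ls ∧ Disjoint Ls S ∧ (∀ c, Sum.inl c ∈ S → c ∈ Zs) ∧
      Disjoint Zs Z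

/-- Every vertex has many out-edges labelled from any set of labels amidst `u` and the vertex. -/
def IsExpanding [Fintype X] (D : LabelledDigraph V X) (u : V) (η : ℝ) : Prop :=
  ∀ (v : V) (A : Set (V ⊕ X)), (∀ l ∈ A, D.Amidst u v l) →
    (A.ncard : ℝ) - Fintype.card X + η ≤ ((D.outNeighbors A v).ncard : ℝ)

namespace IsHub

variable {u w v : V} {k e : ℕ} {U : Finset V} {E : Finset (V ⊕ X)}
  {conf : V ⊕ X → Finset (V ⊕ X)} {Zs : Finset V} {Ls : Finset (V ⊕ X)}

/-- The labels of the appended path are added to the demand `S` made on the hub and its vertices to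
the set to be avoided. The hub's trail then visits the vertex labels needed, uses none of the labels
in advance, and stays disjoint from the path. -/
theorem exists_trail (hub : D.IsHub u w k e U E conf)
    (hp : ConflictFreePath (D.HubEdge U E) conf w v Zs Ls) {S : Finset (V ⊕ X)} {Z : Finset V}
    (hS : #S + #Ls ≤ k) (hZ : #Z + #Zs ≤ k) (hSU : ∀ c, Sum.inl c ∈ S → c ∈ U)
    (hSE : Disjoint S E) (hSS : ∀ a ∈ S, ∀ b ∈ S, a ≠ b → b ∉ conf a)
    (hSL : ∀ a ∈ S, ∀ b ∈ Ls, a ∉ conf b) (hZU : ∀ z ∈ Z, z ∉ U ∧ Sum.inl z ∉ E) :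
    ∃ Zs' Ls', D.SwitchingTrail u v (Zs' ∪ Zs) (Ls' ∪ Ls) ∧ Disjoint (Ls' ∪ Ls) S ∧
      (∀ c, Sum.inl c ∈ S → c ∈ Zs') ∧ Disjoint Zs' Z ∧
      (∀ c ∈ Zs, Sum.inl c ∉ Ls' ∪ Ls) := by
  have hLU : ∀ l ∈ Ls, (∀ c, l = Sum.inl c → c ∈ U) ∧ l ∉ E :=
    hp.label_prop fun x y l h => ⟨h.2.1, h.2.2.1⟩
  have hZsU : ∀ z ∈ Zs, z ∉ U ∧ Sum.inl z ∉ E := hp.vertex_prop fun x y l h => h.2.2.2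
  obtain ⟨Zs', Ls', ht, h1, h2, h3⟩ := hub.route (S ∪ Ls) (Z ∪ Zs)
    ((card_union_le _ _).trans hS) ((card_union_le _ _).trans hZ)
    (by
      intro c hc
      obtain hc | hc := mem_union.1 hc
      · exact hSU c hc
      · exact (hLU _ hc).1 c rfl)
    (disjoint_union_left.2 ⟨hSE, disjoint_left.2 fun l hl => (hLU l hl).2⟩)
    (by
      intro a ha b hb hab
      obtain ha | ha := mem_union.1 ha <;> obtain hb | hb := mem_union.1 hb
      · exact hSS a ha b hb hab
      · exact fun h => hSL a ha b hb (hub.conflict.symm h)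
      · exact hSL b hb a ha
      · exact hp.indep hub.conflict a ha b hb hab)
    (by
      intro z hz
      obtain hz | hz := mem_union.1 hz
      · exact hZU z hz
      · exact hZsU z hz)
  rw [disjoint_union_right] at h1 h3
  refine ⟨Zs', Ls', ht.append hub.conflict.refl (fun _ _ _ h => h.1) hp ?_ h1.2 ?_,
    disjoint_union_left.2 ⟨h1.1, ?_⟩, fun c hc => h2 c (mem_union_left _ hc), h3.1, ?_⟩
  · intro z hz
    refine ⟨disjoint_right.1 h3.2 hz, ?_⟩
    rintro rfl
    exact (hZsU z hz).2 hub.start_mem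
  · exact fun c hc => h2 c (mem_union_right _ hc)
  · exact disjoint_left.2 fun l hl hl' => hSL l hl' l hl (hub.conflict.refl l)
  -- A vertex label of the hub's trail is a vertex of that trail, which avoids the path. Vertex
  -- labels of the path lie in `U`, but its vertices do not.
  · intro c hc h
    obtain h | h := mem_union.1 h
    · exact disjoint_right.1 h3.2 hc (ht.mem_of_inl_mem h)
    · exact (hZsU c hc).1 ((hLU _ h).1 c rfl)

/-- All but `e * (i + 1)` labels of `U ∪ X` are amidst `u` and `v`, so the term `-|X|` of the
expansion cancels and at least about `|U| + η` out-neighbours remain. Discarding heads in `U`, in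
`Zs` and in `E` still leaves `η` up to a bounded error. -/
theorem le_card_extensions [Fintype V] [Fintype X] (hub : D.IsHub u w k e U E conf) {η : ℝ}
    (hD : D.IsExpanding u η) (hp : ConflictFreePath (D.HubEdge U E) conf w v Zs Ls) {i : ℕ}
    (hZs : #Zs ≤ i) (hLs : #Ls ≤ i) (hi : i + 1 ≤ k) :
    η - (e * (i + 2) + i) ≤
      ({z | ∃ l, D.HubEdge U E v z l ∧ z ∉ Zs ∧ ∀ m ∈ Ls, l ∉ conf m}.ncard : ℝ) := by
  classical
  obtain ⟨A, hA⟩ : ∃ A : Finset (V ⊕ X),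
      A = U.disjSum univ \ (E ∪ Ls.biUnion conf) := ⟨_, rfl⟩
  have hmem : ∀ l ∈ A, (∀ c, l = Sum.inl c → c ∈ U) ∧ l ∉ E ∧ ∀ m ∈ Ls, l ∉ conf m := by
    intro l hl
    rw [hA, mem_sdiff, mem_union, not_or, mem_biUnion] at hl
    refine ⟨?_, hl.2.1, fun m hm h => hl.2.2 ⟨m, hm, h⟩⟩
    rintro c rfl
    exact inl_mem_disjSum.1 hl.1
  have hAcard : (#U : ℝ) + Fintype.card X - e * (i + 1) ≤ #A := by
    have h1 : #(U.disjSum (univ : Finset X)) ≤ #A + #(E ∪ Ls.biUnion conf) := by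
      rw [hA]; exact card_le_card_sdiff_add_card
    have h2 : #(E ∪ Ls.biUnion conf) ≤ e + e * i :=
      (card_union_le _ _).trans (Nat.add_le_add hub.card_le
        ((hub.conflict.card_biUnion_le _).trans (Nat.mul_le_mul_left _ hLs)))
    rw [card_disjSum, card_univ] at h1
    have h3 : (#U : ℝ) + Fintype.card X ≤ #A + (e + e * i) := by
      exact_mod_cast h1.trans (Nat.add_le_add_left h2 _)
    linarith
  have hamidst : ∀ l ∈ (A : Set (V ⊕ X)), D.Amidst u v l := by
    intro l hl
    obtain ⟨h1, h2, h3⟩ := hmem l hl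
    obtain ⟨Zs', Ls', ht, h4, h5, -, -⟩ := hub.exists_trail hp (S := {l}) (Z := ∅)
      (by rw [card_singleton]; omega) (by rw [card_empty]; omega)
      (fun c hc => h1 c (mem_singleton.1 hc).symm) (disjoint_singleton_left.2 h2)
      (fun a ha b hb hab => absurd ((mem_singleton.1 ha).trans (mem_singleton.1 hb).symm) hab)
      (fun a ha b hb => by rw [mem_singleton.1 ha]; exact h3 b hb) (by simp)
    exact ht.amidst (disjoint_singleton_right.1 h4)
      fun c hc => mem_union_left _ (h5 c (mem_singleton.2 hc.symm))
  have h1 := hD v A hamidst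
  rw [Set.ncard_coe_finset] at h1
  have h2 : D.outNeighbors A v ⊆
      {z | ∃ l, D.HubEdge U E v z l ∧ z ∉ Zs ∧ ∀ m ∈ Ls, l ∉ conf m} ∪
        ↑(U ∪ Zs ∪ ({z | Sum.inl z ∈ E} : Finset V)) := by
    rintro z ⟨l, hl, hvz⟩
    obtain ⟨h1, h2, h3⟩ := hmem l hl
    by_cases hz : z ∈ U ∪ Zs ∪ ({z | Sum.inl z ∈ E} : Finset V)
    · exact Or.inr hz
    · simp only [mem_union, mem_filter, mem_univ, true_and, not_or] at hz
      exact Or.inl ⟨l, ⟨hvz, h1, h2, hz.1.1, hz.2⟩, hz.1.2, h3⟩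
  have h3 := (Set.ncard_le_ncard h2 (Set.toFinite _)).trans (Set.ncard_union_le _ _)
  rw [Set.ncard_coe_finset] at h3
  have h4 : #({z | Sum.inl z ∈ E} : Finset V) ≤ e := by
    refine le_trans ?_ hub.card_le
    refine card_le_card_of_injOn (fun z => (Sum.inl z : V ⊕ X)) ?_ Sum.inl_injective.injOn
    intro z hz
    simpa using hz
  have h5 : #(U ∪ Zs ∪ ({z | Sum.inl z ∈ E} : Finset V)) ≤ #U + i + e :=
    (card_union_le _ _).trans (Nat.add_le_add ((card_union_le _ _).trans
      (Nat.add_le_add_left hZs _)) h4)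
  have h6 : ((D.outNeighbors A v).ncard : ℝ) ≤
      ({z | ∃ l, D.HubEdge U E v z l ∧ z ∉ Zs ∧ ∀ m ∈ Ls, l ∉ conf m}.ncard : ℝ) +
        (#U + i + e) := by exact_mod_cast h3.trans (Nat.add_le_add_left h5 _)
  linarith

/-- Among the vertices that can be reached from a hub, there is a set in which all out-degrees
are large. -/
theorem exists_layer [Fintype V] [Fintype X] (hub : D.IsHub u w k e U E conf) {η : ℝ}
    (hη : 0 < η) (hD : D.IsExpanding u η) {I : ℕ} (hI : I + 1 ≤ k)
    (hηI : e * (I + 2) + I ≤ η / 4) (hIV : Fintype.card V < I * (η / 4)) :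
    ∃ W : Finset V, W.Nonempty ∧ w ∉ W ∧ (∀ y ∈ W, y ∉ U ∧ Sum.inl y ∉ E) ∧
      (∀ y ∈ W, ∃ Zs Ls, ConflictFreePath (D.HubEdge U E) conf w y Zs Ls ∧ #Zs ≤ I ∧ #Ls ≤ I) ∧
      ∀ x ∈ W, η / 2 ≤ ({z | ∃ l, x ∈ W ∧ z ∈ W ∧ D.HubEdge U E x z l}.ncard : ℝ) := by
  classical
  obtain ⟨R, hR⟩ : ∃ R : ℕ → Finset V, ∀ i v, v ∈ R i ↔
      ∃ Zs Ls, ConflictFreePath (D.HubEdge U E) conf w v Zs Ls ∧ #Zs ≤ i ∧ #Ls ≤ i :=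
    ⟨fun i => {v | ∃ Zs Ls, ConflictFreePath (D.HubEdge U E) conf w v Zs Ls ∧ #Zs ≤ i ∧ #Ls ≤ i},
      fun i v => by simp⟩
  have hmono : ∀ i, R i ⊆ R (i + 1) := by
    intro i v hv
    rw [hR] at hv ⊢
    obtain ⟨Zs, Ls, h, h1, h2⟩ := hv
    exact ⟨Zs, Ls, h, by omega, by omega⟩
  obtain ⟨i, hi, hgrow⟩ : ∃ i < I, (#(R (i + 1)) : ℝ) ≤ #(R i) + η / 4 := by
    by_contra! hcon
    have h : ∀ i ≤ I, i * (η / 4) ≤ (#(R i) : ℝ) := by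
      intro i
      induction i with
      | zero => intro _; simp
      | succ i ih =>
        intro hi
        have h1 := ih (by omega)
        have h2 := hcon i (by omega)
        push_cast
        linarith
    have h1 : (#(R I) : ℝ) ≤ Fintype.card V := by exact_mod_cast card_le_univ (R I)
    have h2 := h I le_rfl
    linarith
  -- There are at least `3η/4` admissible extensions, and at most `η/4` of them lead to the new
  -- vertices of `R (i + 1)`.
  have hdeg : ∀ x ∈ R i,
      η / 2 ≤ ({z | ∃ l, z ∈ (R i).erase w ∧ D.HubEdge U E x z l}.ncard : ℝ) := by
    intro x hx
    obtain ⟨Zs, Ls, hp, h1, h2⟩ := (hR i x).1 hx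
    have h3 := hub.le_card_extensions hD hp h1 h2 (by omega)
    have h4 : {z | ∃ l, D.HubEdge U E x z l ∧ z ∉ Zs ∧ ∀ m ∈ Ls, l ∉ conf m} ⊆
        {z | ∃ l, z ∈ (R i).erase w ∧ D.HubEdge U E x z l} ∪ ↑(R (i + 1) \ R i) := by
      rintro z ⟨l, hxz, hz, hl⟩
      have hzw : z ≠ w := fun h => hxz.2.2.2.2 (h ▸ hub.root_mem)
      by_cases hzi : z ∈ R i
      · exact Or.inl ⟨l, mem_erase.2 ⟨hzw, hzi⟩, hxz⟩
      · refine Or.inr (mem_sdiff.2 ⟨(hR _ _).2 ⟨_, _, hp.snoc hxz hz hzw hl, ?_, ?_⟩, hzi⟩)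
        · exact (card_insert_le _ _).trans (by omega)
        · exact (card_insert_le _ _).trans (by omega)
    have h5 := (Set.ncard_le_ncard h4 (Set.toFinite _)).trans (Set.ncard_union_le _ _)
    rw [Set.ncard_coe_finset] at h5
    have h6 : #(R (i + 1) \ R i) + #(R i) = #(R (i + 1)) := card_sdiff_add_card_eq_card (hmono i)
    have h7 : (#(R (i + 1) \ R i) : ℝ) + #(R i) = #(R (i + 1)) := by exact_mod_cast h6
    have h8 : ({z | ∃ l, D.HubEdge U E x z l ∧ z ∉ Zs ∧ ∀ m ∈ Ls, l ∉ conf m}.ncard : ℝ) ≤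
        ({z | ∃ l, z ∈ (R i).erase w ∧ D.HubEdge U E x z l}.ncard : ℝ) + #(R (i + 1) \ R i) := by
      exact_mod_cast h5
    have h9 : (e : ℝ) * (i + 2) + i ≤ e * (I + 2) + I := by
      have : (i : ℝ) ≤ I := by exact_mod_cast hi.le
      gcongr
    linarith
  have hpath : ∀ y ∈ (R i).erase w, ∃ Zs Ls,
      ConflictFreePath (D.HubEdge U E) conf w y Zs Ls ∧ #Zs ≤ I ∧ #Ls ≤ I := by
    intro y hy
    obtain ⟨Zs, Ls, hp, h1, h2⟩ := (hR i y).1 (mem_of_mem_erase hy)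
    exact ⟨Zs, Ls, hp, by omega, by omega⟩
  refine ⟨(R i).erase w, ?_, notMem_erase _ _, ?_, hpath, ?_⟩
  · have hpos : 0 < ({z | ∃ l, z ∈ (R i).erase w ∧ D.HubEdge U E w z l}.ncard : ℝ) :=
      lt_of_lt_of_le (by linarith) (hdeg w ((hR i w).2 ⟨∅, ∅, .nil, by simp, by simp⟩))
    obtain ⟨z, l, hz, -⟩ := Set.nonempty_of_ncard_ne_zero
      (by exact_mod_cast hpos.ne' : {z | ∃ l, z ∈ (R i).erase w ∧ D.HubEdge U E w z l}.ncard ≠ 0)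
    exact ⟨z, hz⟩
  · intro y hy
    obtain ⟨Zs, Ls, hp, -, -⟩ := hpath y hy
    obtain h | h := hp.end_mem
    · exact absurd h (ne_of_mem_erase hy)
    · exact hp.vertex_prop (p := fun y => y ∉ U ∧ Sum.inl y ∉ E) (fun _ _ _ h => h.2.2.2) y h
  · intro x hx
    refine (hdeg x (mem_of_mem_erase hx)).trans ?_
    have : {z | ∃ l, z ∈ (R i).erase w ∧ D.HubEdge U E x z l} ⊆
        {z | ∃ l, x ∈ (R i).erase w ∧ z ∈ (R i).erase w ∧ D.HubEdge U E x z l} :=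
      fun z ⟨l, hz, h⟩ => ⟨l, hx, hz, h⟩
    exact_mod_cast Set.ncard_le_ncard this (Set.toFinite _)

end IsHub

theorem card_filter_extendBySingleton_le [Fintype V] [Fintype X] {C : Finset V}
    {F : V → Finset (V ⊕ X)} {M : ℕ} (hF : ∀ f, #{c | f ∈ F c} ≤ M) (f : V ⊕ X) :
    #{l | f ∈ extendBySingleton C F l} ≤ M + 1 := by
  have h : ({l | f ∈ extendBySingleton C F l} : Finset (V ⊕ X)) ⊆
      insert f (({c | f ∈ F c} : Finset V).image Sum.inl) := by
    intro l hl
    have hl' := (mem_filter.1 hl).2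
    by_cases h : ∃ c ∈ C, l = Sum.inl c
    · obtain ⟨c, hc, rfl⟩ := h
      rw [extendBySingleton_of_mem hc] at hl'
      exact mem_insert_of_mem (mem_image_of_mem _ (by simpa using hl'))
    · push Not at h
      rw [extendBySingleton_of_notMem fun c hlc hc => h c hc hlc, mem_singleton] at hl'
      exact hl' ▸ mem_insert_self _ _
  exact (card_le_card h).trans ((card_insert_le _ _).trans
    (Nat.succ_le_succ (card_image_le.trans (hF f))))

/-- A set `C` of pairwise linked vertices beyond a hub can be added to the set of the hub. -/
theorem IsHub.extend [Fintype V] [Fintype X] {u w w' x : V} {k e I d M : ℕ} {U W C Zq : Finset V}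
    {E Lq : Finset (V ⊕ X)} {conf : V ⊕ X → Finset (V ⊕ X)} {F : V → Finset (V ⊕ X)}
    (hub : D.IsHub u w (k + I + 1 + d) e U E conf) (hwW : w ∉ W)
    (hWU : ∀ y ∈ W, y ∉ U ∧ Sum.inl y ∉ E) (hCW : C ⊆ W) (hx : x ∈ C) (hw' : w' ∈ C)
    (hq : ConflictFreePath (D.HubEdge U E) conf w x Zq Lq) (hZq : #Zq ≤ I) (hLq : #Lq ≤ I)
    (hF : ∀ c, #(F c) ≤ M) (hF' : ∀ f, #{c | f ∈ F c} ≤ M)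
    (hw'q : w' ∉ Zq) (hw'L : Disjoint (F w') (Lq.biUnion conf))
    (hlink : ∀ (y : V) (T : Finset V) (Y : Finset (V ⊕ X)) (Z : Finset V),
      y ∈ C → T ⊆ C → x ≠ y → x ∉ T → y ∉ T → #T ≤ k → #Y ≤ e * (k + I) + k + I →
      #Z ≤ e * (k + I) + k + I → (∀ a ∈ insert y T, Disjoint (F a) Y ∧ a ∉ Z) →
      (∀ a ∈ insert y T, ∀ b ∈ insert y T, a ≠ b → Disjoint (F a) ((F b).biUnion conf)) →
      Linked (fun a b l => a ∈ W ∧ b ∈ W ∧ D.HubEdge U E a b l) conf d x y T Y Z) :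
    ∃ E' conf', D.IsHub u w' k (e * (M + 1) * (M + 1) + 1 + (e + I + 1 + e * (I + M) * (M + 1)))
      (U ∪ C) E' conf' := by
  -- `G l` collects the labels to be kept free for a demand `l`: the set `F c` for entering `c ∈ C`,
  -- and `l` itself if the old hub has to provide it.
  obtain ⟨G, hG⟩ : ∃ G : V ⊕ X → Finset (V ⊕ X), G = extendBySingleton C F := ⟨_, rfl⟩
  have hGC : ∀ c ∈ C, G (Sum.inl c) = F c := fun c hc => by rw [hG, extendBySingleton_of_mem hc]
  have hGl : ∀ l, (∀ c, l = Sum.inl c → c ∉ C) → G l = {l} := fun l hl => by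
    rw [hG, extendBySingleton_of_notMem hl]
  have hGM : ∀ l, #(G l) ≤ M + 1 := fun l => hG ▸ card_extendBySingleton_le hF l
  have hGM' : ∀ f, #{l | f ∈ G l} ≤ M + 1 := fun f => hG ▸ card_filter_extendBySingleton_le hF' f
  have hxw : x ≠ w := fun h => hwW (h ▸ hCW hx)
  have hxq : x ∈ Zq := hq.end_mem.resolve_left hxw
  have hCU : ∀ c ∈ C, c ∉ U := fun c hc => (hWU c (hCW hc)).1
  have hc := hub.conflict
  obtain ⟨Q, hQ⟩ : ∃ Q : Finset (V ⊕ X), Q = (Lq ∪ F w').biUnion conf := ⟨_, rfl⟩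
  have hQcard : #Q ≤ e * (I + M) := by
    rw [hQ]
    exact (hc.card_biUnion_le _).trans (Nat.mul_le_mul_left _ ((card_union_le _ _).trans
      (Nat.add_le_add hLq (hF w'))))
  -- New exceptions: the vertices of the fixed path to `x`, the new root, and every label whose `G`
  -- conflicts with that path's labels or with `F w'`.
  obtain ⟨E', hE'⟩ : ∃ E' : Finset (V ⊕ X), E' = E ∪ Zq.image Sum.inl ∪ {Sum.inl w'} ∪
      ({l | ∃ f ∈ G l, f ∈ Q} : Finset (V ⊕ X)) := ⟨_, rfl⟩
  have hmemE' : ∀ l, l ∉ E' ↔ l ∉ E ∧ l ∉ Zq.image Sum.inl ∧ l ≠ Sum.inl w' ∧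
      Disjoint (G l) Q := by
    intro l
    simp only [hE', mem_union, mem_singleton, mem_filter, mem_univ, true_and, not_or,
      disjoint_left, not_exists, not_and, and_assoc]
  refine ⟨E', pullConflict conf G, ?_, ?_, ?_, ?_, ?_⟩
  · obtain ⟨h1, h2, h3⟩ := hc.pull hGM' hGM
    exact ⟨h1, h2, fun l => (h3 l).trans (Nat.le_add_right _ _)⟩
  · rw [hE']
    exact mem_union_left _ (mem_union_left _ (mem_union_left _ hub.start_mem))
  · rw [hE']
    exact mem_union_left _ (mem_union_right _ (mem_singleton_self _))
  · refine le_trans ?_ (Nat.le_add_left _ _)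
    rw [hE']
    refine (card_union_le _ _).trans (Nat.add_le_add ((card_union_le _ _).trans
      (Nat.add_le_add ((card_union_le _ _).trans (Nat.add_le_add hub.card_le
        (card_image_le.trans hZq))) (card_singleton _).le)) ?_)
    exact (card_filter_meets_le hGM' Q).trans (Nat.mul_le_mul_right _ hQcard)
  intro S Z hS hZ hSU hSE hSS hZU
  have hSE' : ∀ l ∈ S, l ∉ E ∧ l ∉ Zq.image Sum.inl ∧ l ≠ Sum.inl w' ∧ Disjoint (G l) Q :=
    fun l hl => (hmemE' l).1 (disjoint_left.1 hSE hl)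
  have hZE' : ∀ z ∈ Z, z ∉ U ∧ z ∉ C ∧ Sum.inl z ∉ E ∧ z ∉ Zq := by
    intro z hz
    obtain ⟨h1, h2⟩ := hZU z hz
    rw [mem_union, not_or] at h1
    rw [hmemE'] at h2
    exact ⟨h1.1, h1.2, h2.1, fun h => h2.2.1 (mem_image_of_mem _ h)⟩
  -- Labels of `S` at vertices of `C` are dealt with by the new path, the others by the old hub.
  obtain ⟨T, hT⟩ : ∃ T : Finset V, T = {c ∈ C | Sum.inl c ∈ S} := ⟨_, rfl⟩
  obtain ⟨S₁, hS₁⟩ : ∃ S₁ : Finset (V ⊕ X), S₁ = {l ∈ S | l ∉ C.image Sum.inl} := ⟨_, rfl⟩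
  have hTmem : ∀ c ∈ T, c ∈ C ∧ Sum.inl c ∈ S := fun c hc => by
    rw [hT] at hc; exact mem_filter.1 hc
  have hS₁mem : ∀ l ∈ S₁, l ∈ S ∧ G l = {l} := fun l hl => by
    rw [hS₁] at hl
    obtain ⟨h1, h2⟩ := mem_filter.1 hl
    exact ⟨h1, hGl l fun c hlc hc => h2 (hlc ▸ mem_image_of_mem _ hc)⟩
  have hS₁card : #S₁ ≤ k := by
    rw [hS₁]; exact (card_le_card (filter_subset _ _)).trans hS
  have hTcard : #T ≤ k := by
    refine le_trans (card_le_card_of_injOn (fun z => (Sum.inl z : V ⊕ X)) ?_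
      Sum.inl_injective.injOn) hS
    exact fun c hc => (hTmem c hc).2
  have hsplit : ∀ l ∈ S, l ∈ S₁ ∨ ∃ c ∈ T, l = Sum.inl c := by
    intro l hl
    by_cases h : l ∈ C.image Sum.inl
    · obtain ⟨c, hc, rfl⟩ := mem_image.1 h
      exact Or.inr ⟨c, by rw [hT]; exact mem_filter.2 ⟨hc, hl⟩, rfl⟩
    · exact Or.inl (by rw [hS₁]; exact mem_filter.2 ⟨hl, h⟩)
  have hpull : ∀ a ∈ S, ∀ b ∈ S, a ≠ b → Disjoint (G b) ((G a).biUnion conf) := by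
    intro a ha b hb hab
    have := hSS a ha b hb hab
    simp only [pullConflict, mem_insert, mem_filter, mem_univ, true_and, not_or, not_exists,
      not_and] at this
    exact disjoint_left.2 this.2
  have hTq : ∀ c ∈ T, c ∉ Zq ∧ c ≠ w' ∧ Disjoint (F c) Q := by
    intro c hc
    obtain ⟨h1, h2⟩ := hTmem c hc
    obtain ⟨-, h3, h4, h5⟩ := hSE' _ h2
    rw [hGC c h1] at h5
    exact ⟨fun h => h3 (mem_image_of_mem _ h), fun h => h4 (h ▸ rfl), h5⟩
  have hQL : Lq.biUnion conf ⊆ Q := hQ ▸ biUnion_subset_biUnion_of_subset_left _ subset_union_left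
  have hQF : (F w').biUnion conf ⊆ Q :=
    hQ ▸ biUnion_subset_biUnion_of_subset_left _ subset_union_right
  have hS₁Q : Disjoint S₁ Q := by
    rw [disjoint_left]
    intro l hl
    obtain ⟨h1, h2⟩ := hS₁mem l hl
    have := (hSE' l h1).2.2.2
    rwa [h2, disjoint_singleton_left] at this
  -- The path in the core visits all demanded vertices of `C` and avoids conflicts with `S₁`, left
  -- to the old hub, and with the fixed path's labels.
  obtain ⟨Zs, Ls, hp, hZs, hLs, hLY, hZZ, hTZ⟩ := hlink w' T ((S₁ ∪ Lq).biUnion conf) (Z ∪ Zq) hw'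
    (fun c hc => (hTmem c hc).1) (fun h => hw'q (h ▸ hxq)) (fun h => (hTq x h).1 hxq)
    (fun h => (hTq w' h).2.1 rfl) hTcard
    (by
      have h1 := (hc.card_biUnion_le (S₁ ∪ Lq)).trans (Nat.mul_le_mul_left _
        ((card_union_le _ _).trans (Nat.add_le_add hS₁card hLq)))
      omega)
    ((card_union_le _ _).trans (by omega))
    (by
      intro a ha
      rw [union_biUnion, disjoint_union_right, mem_union, not_or]
      obtain rfl | ha := mem_insert.1 ha
      · exact ⟨⟨hc.disjoint_biUnion_comm (disjoint_of_subset_right hQF hS₁Q), hw'L⟩,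
          fun h => (hZE' a h).2.1 hw', hw'q⟩
      · obtain ⟨h1, h2⟩ := hTmem a ha
        refine ⟨⟨?_, disjoint_of_subset_right hQL (hTq a ha).2.2⟩,
          fun h => (hZE' a h).2.1 h1, (hTq a ha).1⟩
        rw [disjoint_biUnion_right]
        intro l hl
        obtain ⟨h3, h4⟩ := hS₁mem l hl
        have hne : l ≠ Sum.inl a := by
          rintro rfl
          rw [hS₁] at hl
          exact (mem_filter.1 hl).2 (mem_image_of_mem _ h1)
        have h5 := hpull l h3 _ h2 hne
        rwa [hGC a h1, h4, singleton_biUnion] at h5)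
    (by
      intro a ha b hb hab
      obtain ha | ha := mem_insert.1 ha <;> obtain hb | hb := mem_insert.1 hb
      · exact absurd (ha.trans hb.symm) hab
      · rw [ha]
        exact hc.disjoint_biUnion_comm (disjoint_of_subset_right hQF (hTq b hb).2.2)
      · rw [hb]
        exact disjoint_of_subset_right hQF (hTq a ha).2.2
      · have h1 := hpull _ (hTmem b hb).2 _ (hTmem a ha).2 (fun h => hab (Sum.inl_injective h).symm)
        rwa [hGC a (hTmem a ha).1, hGC b (hTmem b hb).1] at h1)
  rw [union_biUnion, disjoint_union_right] at hLY
  rw [disjoint_union_right] at hZZ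
  have hZsW : ∀ z ∈ Zs, z ∈ W := hp.vertex_prop fun _ _ _ h => h.2.1
  have hpath := hq.trans (hp.mono fun _ _ _ h => h.2.2)
    (fun z hz => ⟨disjoint_left.1 hZZ.2 hz, fun h => hwW (h ▸ hZsW z hz)⟩)
    (fun l hl m hm h => disjoint_left.1 hLY.2 hl (mem_biUnion.2 ⟨m, hm, h⟩))
  have hLc : #(Lq ∪ Ls) ≤ I + d := (card_union_le _ _).trans (Nat.add_le_add hLq hLs)
  have hZc : #(Zq ∪ Zs) ≤ I + d := (card_union_le _ _).trans (Nat.add_le_add hZq hZs)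
  obtain ⟨Zs', Ls', ht, h1, h2, h3, h4⟩ := hub.exists_trail hpath (S := S₁) (Z := Z)
    (by omega) (by omega)
    (by
      intro c hc
      have h := hSU c (hS₁mem _ hc).1
      rw [mem_union] at h
      refine h.resolve_right fun h => ?_
      rw [hS₁] at hc
      exact (mem_filter.1 hc).2 (mem_image_of_mem _ h))
    (disjoint_left.2 fun l hl => (hSE' l (hS₁mem l hl).1).1)
    (by
      intro a ha b hb hab h
      have h5 := hpull a (hS₁mem a ha).1 b (hS₁mem b hb).1 hab
      rw [(hS₁mem a ha).2, (hS₁mem b hb).2, singleton_biUnion, disjoint_singleton_left] at h5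
      exact h5 h)
    (by
      intro a ha b hb h
      obtain hb | hb := mem_union.1 hb
      · exact disjoint_left.1 hS₁Q ha (hQL (mem_biUnion.2 ⟨b, hb, h⟩))
      · exact disjoint_left.1 hLY.1 hb (mem_biUnion.2 ⟨a, ha, hc.symm h⟩))
    (fun z hz => ⟨(hZE' z hz).1, (hZE' z hz).2.2.1⟩)
  refine ⟨_, _, ht, ?_, ?_, ?_⟩
  · rw [disjoint_right]
    intro l hl
    obtain hl | ⟨c, hc, rfl⟩ := hsplit l hl
    · exact disjoint_right.1 h1 hl
    · exact h4 c (mem_union_right _ (hTZ hc))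
  · intro c hc
    obtain hl | ⟨c', hc', h⟩ := hsplit _ hc
    · exact mem_union_left _ (h2 c hl)
    · rw [Sum.inl_injective h]
      exact mem_union_right _ (mem_union_right _ (hTZ hc'))
  · refine disjoint_union_left.2 ⟨h3, disjoint_union_left.2 ⟨?_, hZZ.1⟩⟩
    exact disjoint_right.2 fun z hz => (hZE' z hz).2.2.2

end LabelledDigraph

/-! ### Iterating the extension -/

namespace LabelledDigraph

/-- Each round gains at least `δn` vertices with the same `δ`; only `e` and `N` deteriorate with `s`
and `k`. All `k` are treated at once because a hub serving `k` demands is built from one with a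
larger capacity. -/
theorem exists_hub (ε : ℝ) (hε : 0 < ε) (hε' : ε ≤ 9 / 10) :
    ∃ δ : ℝ, 0 < δ ∧ ∀ s k : ℕ, ∃ e N : ℕ, ∀ {V X : Type*} [Fintype V] [Fintype X]
      [DecidableEq V] [DecidableEq X] (D : LabelledDigraph V X) (u : V), D.OutProper →
      N ≤ Fintype.card V → D.IsExpanding u (ε * Fintype.card V) →
      ∃ (U : Finset V) (w : V) (E : Finset (V ⊕ X)) (conf : V ⊕ X → Finset (V ⊕ X)),
        D.IsHub u w k e U E conf ∧ s * (δ * Fintype.card V) ≤ (#U : ℝ) := by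
  obtain ⟨δ, hδ, d, hcore⟩ := exists_linked_core (ε / 2) (by linarith) (by linarith)
  refine ⟨δ, hδ, fun s => ?_⟩
  induction s with
  | zero =>
    intro k
    refine ⟨1, 0, ?_⟩
    intro V X _ _ _ _ D u _ _ _
    refine ⟨∅, u, {Sum.inl u}, fun l => {l}, ⟨⟨by simp, ?_, by simp⟩, by simp, by simp, by simp,
      ?_⟩, by simp⟩
    · intro l m h
      rw [mem_singleton] at h ⊢
      exact h.symm
    · intro S Z _ _ hSU _ _ _
      exact ⟨∅, ∅, .nil, by simp, fun c hc => absurd (hSU c hc) (notMem_empty c), by simp⟩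
  | succ s ih =>
    intro k
    obtain ⟨I, hI⟩ := exists_nat_gt (1 / (ε / 4))
    -- The old hub must serve `k` demands, at most `I` labels on the path to the core and `(k + 1) *
    -- d` labels inside it. The extra `1` covers `I + 1 ≤ k` in `exists_layer`.
    obtain ⟨e, N₀, hhub⟩ := ih (k + I + 1 + (k + 1) * d)
    obtain ⟨θ, hθ, N₁, hlink⟩ := hcore e k (e * (k + I) + k + I)
    obtain ⟨M, hM⟩ := exists_nat_ge (1 / θ)
    obtain ⟨N₂, hN₂⟩ := exists_nat_gt ((e * (I + 2) + I) / (ε / 4))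
    obtain ⟨N₃, hN₃⟩ := exists_nat_gt ((I + e * I * M) / δ)
    refine ⟨e * (M + 1) * (M + 1) + 1 + (e + I + 1 + e * (I + M) * (M + 1)),
      N₀ + N₁ + N₂ + N₃, ?_⟩
    intro V X _ _ _ _ D u hD hN hexp
    have hV : 0 < Fintype.card V := Fintype.card_pos_iff.2 ⟨u⟩
    obtain ⟨n, hn⟩ : ∃ n : ℝ, n = Fintype.card V := ⟨_, rfl⟩
    have hn0 : 0 < n := by rw [hn]; exact_mod_cast hV
    have hN₂' : (N₂ : ℝ) ≤ n := by
      rw [hn]; exact_mod_cast (show N₂ ≤ Fintype.card V by omega)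
    have hN₃' : (N₃ : ℝ) ≤ n := by
      rw [hn]; exact_mod_cast (show N₃ ≤ Fintype.card V by omega)
    rw [div_lt_iff₀ (by positivity)] at hI hN₂ hN₃
    obtain ⟨U, w, E, conf, hub, hU⟩ := hhub D u hD (by omega) hexp
    obtain ⟨W, hW, hwW, hWU, hWpath, hdeg⟩ := hub.exists_layer (by rw [← hn]; positivity) hexp
      (I := I) (by omega) (by rw [← hn]; nlinarith) (by rw [← hn]; nlinarith)
    obtain ⟨H, hH⟩ : ∃ H : V → V → V ⊕ X → Prop,
      H = fun a b l => a ∈ W ∧ b ∈ W ∧ D.HubEdge U E a b l := ⟨_, rfl⟩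
    have hlab : IsOutLabelling W H := by
      rw [hH]
      exact ⟨fun h => h.1, fun h => h.2.1, fun h h' => h.2.2.1.unique h'.2.2.1,
        fun h h' => hD _ _ _ _ h.2.2.1 h'.2.2.1⟩
    obtain ⟨C, hCW, hC, hCl⟩ := hlink W H conf hlab hub.conflict (by omega) hW (by
      intro x hx
      rw [hH]
      exact le_trans (le_of_eq (by ring)) (hdeg x hx))
    have hCU : Disjoint U C := disjoint_right.2 fun c hc => (hWU c (hCW hc)).1
    have hC0 : (0 : ℝ) < #C := lt_of_lt_of_le (by rw [← hn]; positivity) hC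
    obtain ⟨x, hx⟩ : C.Nonempty := card_pos.1 (by exact_mod_cast hC0)
    obtain ⟨Zq, Lq, hq, hZq, hLq⟩ := hWpath x (hCW hx)
    obtain ⟨F, hF⟩ : ∃ F : V → Finset (V ⊕ X),
      F = heavyLabels H (θ * Fintype.card V) := ⟨_, rfl⟩
    have hFM : ∀ c, #(F c) ≤ M := by
      intro c
      have := (card_heavyLabels_le hlab θ hθ hV c).trans hM
      rw [hF]
      exact_mod_cast this
    have hFM' : ∀ f, #{c | f ∈ F c} ≤ M := by
      intro f
      have := (card_heavy_at_le hlab θ hθ hV f).trans hM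
      rw [hF]
      refine le_trans (le_of_eq ?_) (Nat.cast_le.1 this)
      congr!
    -- The core is linear in size, whereas only boundedly many vertices lie on the path to `x` or
    -- have a heavy label in conflict with its labels.
    obtain ⟨w', hw'C, hw'⟩ : ∃ w' ∈ C,
        w' ∉ Zq ∪ (Lq.biUnion conf).biUnion (fun f => {c | f ∈ F c}) := by
      by_contra! hcon
      have h1 : #C ≤ I + e * I * M := (card_le_card hcon).trans ((card_union_le _ _).trans
        (Nat.add_le_add hZq ((card_biUnion_le_card_mul _ _ M fun f _ => hFM' f).trans
          (Nat.mul_le_mul_right _ ((hub.conflict.card_biUnion_le _).trans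
            (Nat.mul_le_mul_left _ hLq))))))
      have h2 : (#C : ℝ) ≤ I + e * I * M := by exact_mod_cast h1
      rw [← hn] at hC
      nlinarith
    rw [mem_union, not_or] at hw'
    obtain ⟨E', conf', hub'⟩ := hub.extend hwW hWU hCW hx hw'C hq hZq hLq hFM hFM' hw'.1
      (by
        rw [disjoint_right]
        intro f hf hfw
        exact hw'.2 (mem_biUnion.2 ⟨f, hf, by simpa using hfw⟩))
      (by
        intro y T Y Z hy hT hxy hxT hyT hTk hY hZ h1 h2
        rw [hF] at h1 h2
        rw [← hH]
        exact hCl x y T Y Z hx hy hT hxy hxT hyT hTk hY hZ h1 h2)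
    refine ⟨U ∪ C, w', E', conf', hub', ?_⟩
    rw [card_union_of_disjoint hCU]
    push_cast
    linarith

end LabelledDigraph

end

theorem mainTheorem2 (ε : ℝ) (hε : 0 < ε) (hε' : ε ≤ 9 / 10) :
    ∃ N₀ : ℕ, ∀ (V X : Type*) [Fintype V] [Fintype X] (D : LabelledDigraph V X),
      D.OutProper → N₀ ≤ Fintype.card V →
        ∀ u : V, ∃ (v : V) (A : Set (V ⊕ X)),
          (∀ l ∈ A, D.Amidst u v l) ∧
          ((D.outNeighbors A v).ncard : ℝ) <
            (A.ncard : ℝ) - (Fintype.card X : ℝ) + ε * (Fintype.card V : ℝ) := by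
  obtain ⟨δ, hδ, h⟩ := LabelledDigraph.exists_hub ε hε hε'
  obtain ⟨s, hs⟩ := exists_nat_gt (1 / δ)
  -- Only the size of `U` matters at the end, so no demands need to be served and `k = 0` suffices.
  obtain ⟨e, N, hN⟩ := h s 0
  refine ⟨N, fun V X _ _ D hD hn u => ?_⟩
  classical
  by_contra! hcon
  obtain ⟨U, w, E, conf, -, hU⟩ := hN D u hD hn hcon
  have hV : (0 : ℝ) < Fintype.card V := by exact_mod_cast Fintype.card_pos_iff.2 ⟨u⟩
  have hUV : (U.card : ℝ) ≤ Fintype.card V := by exact_mod_cast Finset.card_le_univ U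
  rw [div_lt_iff₀ hδ] at hs
  nlinarith
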